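/- Let $N\ge 4$, $\kappa>0$ and $\epsilon\in\{1,-1\}$. Space-time coordinates are $(y,x^1,\dots,x^{N-1})$ with $y\in I$ ($I\subseteq\mathbb R$ a nonempty open interval) and $x\in\Omega$ ($\Omega\subseteq\mathbb R^{N-1}$ open, nonempty, connected); all metrics are smooth and Lorentzian. A \emph{seed} with cosmological constant $\Lambda$ is a metric $\hat g=\epsilon e^{2V(x)}dy^2+e^{-2V(x)}\hat h_{ij}(x)dx^idx^j$ with $R_{\mu\nu}[\hat g]=\frac{2}{N-2}\Lambda\hat g_{\mu\nu}$. A \emph{template} consists of real numbers $\alpha,\delta,\sigma,\rho$ and a smooth function $\mu(y)$ on $I$; it assigns to a seed the metric and field $$ds^2=e^{2\mu(y)}\left(\epsilon e^{2\alpha V}dy^2+e^{-2\alpha V}e^{-2\delta V}\hat h_{ij}dx^idx^j\right),\qquad \phi=\sigma V(x)+\rho\,\mu(y).$$ It gives a solution of class $\mathcal T_N^\Lambda$ with vanishing potential if $\Lambda\ne0$, $\mu$ is not constant, and $(g,\phi)$ satisfies the Einstein-scalar field equations with potential $W=0$: $R_{\mu\nu}[g]=\kappa\,\partial_\mu\phi\,\partial_\nu\phi$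 and $\Box\phi=0$. The solutions of class $\mathcal T_N^\Lambda$ with vanishing potential form a one-parameter family, parametrized by $\chi<0$, in the following sense. (1) For every $\chi<0$ there are seeds with $\Lambda=-\frac{\epsilon}{2}\frac{(N-2)^3}{N-1}\chi$, and for each such seed, each $I$ and each $\varepsilon=\pm1$, $$ds^2=\epsilon e^{2(\alpha V+\sqrt{-\chi}\,y)}dy^2+e^{-2\gamma V+2\sqrt{-\chi}\,y}\hat h_{ij}dx^idx^j,\qquad \phi=\varepsilon\sqrt{\frac{N-1}{\kappa(N-2)}}\left(V+\frac{N-2}{N-1}\sqrt{-\chi}\,y\right)$$ with $\alpha=\frac1{N-2}$ and $\gamma=\alpha+\frac{N-4}{N-3}(1-\alpha)$ is such a solution. It comes from a template with the parameters $$\lambda=\frac{\varepsilon}{\sqrt{N-1}},\quad \alpha=\frac{\varepsilon\lambda}{\sqrt{N-3+\lambda^2}}=\frac1{N-2},\quad \delta=\frac{N-4}{N-3}(1-\alpha),\quad \sigma=\varepsilon\sqrt{\frac{N-2}{\kappa(N-3+\lambda^2)}},\quad \rho=\sqrt{\frac{N-2}{\kappa}}\,\lambda .$$ (2) Conversely,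 suppose a template with $\delta=\frac{N-4}{N-3}(1-\alpha)$ gives a solution of class $\mathcal T_N^\Lambda$ with vanishing potential from some seed with cosmological constant $\Lambda$. Then there is a unique $\chi<0$ such that $\Lambda=-\frac{\epsilon}{2}\frac{(N-2)^3}{N-1}\chi$ and, for some $\varepsilon=\pm1$, the parameters have the values in (1), $\mu(y)=\sqrt{-\chi}\,Y$ with $Y=s(y-y_0)$ for some $s=\pm1$ and $y_0\in\mathbb R$, and in the coordinate $Y$ the metric and the field take the form in (1). (3) The conclusion of (2) also holds for every template with arbitrary $\delta$ that, for a given $\Lambda\neq0$, gives a solution of class $\mathcal T_N^\Lambda$ with vanishing potential from every seed with cosmological constant $\Lambda$. -/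

import Mathlib

open scoped ContDiff Matrix

noncomputable section

namespace EinsteinScalar

/-! ## Coordinate tensor calculus on open subsets of `ℝ^ι` -/

section Calculus

variable {ι : Type*} [Fintype ι] [DecidableEq ι]

/-- The partial derivative `∂ᵢ f` at `p`. -/
def pderiv (i : ι) (f : (ι → ℝ) → ℝ) (p : ι → ℝ) : ℝ :=
  fderiv ℝ f p (Pi.single i 1)

/-- Christoffel symbols `Γᵏᵢⱼ` of the metric `g`. -/
def christoffel (g : (ι → ℝ) → Matrix ι ι ℝ) (k i j : ι) (p : ι → ℝ) : ℝ :=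
  (1 / 2) * ∑ l, (g p)⁻¹ k l *
    (pderiv i (fun q => g q j l) p + pderiv j (fun q => g q i l) p
      - pderiv l (fun q => g q i j) p)

/-- Ricci tensor
`Rᵢⱼ = ∂ₖ Γᵏᵢⱼ - ∂ⱼ Γᵏᵢₖ + Γᵏₖₗ Γˡᵢⱼ - Γᵏⱼₗ Γˡᵢₖ` (positive on round spheres). -/
def ricci (g : (ι → ℝ) → Matrix ι ι ℝ) (p : ι → ℝ) (i j : ι) : ℝ :=
  (∑ k, (pderiv k (christoffel g k i j) p - pderiv j (christoffel g k i k) p))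
    + ∑ k, ∑ l, (christoffel g k k l p * christoffel g l i j p
        - christoffel g k j l p * christoffel g l i k p)

/-- Laplace (d'Alembert) operator `□φ = gⁱʲ (∂ᵢ∂ⱼ φ - Γᵏᵢⱼ ∂ₖ φ)` of the metric `g`. -/
def box (g : (ι → ℝ) → Matrix ι ι ℝ) (φ : (ι → ℝ) → ℝ) (p : ι → ℝ) : ℝ :=
  ∑ i, ∑ j, (g p)⁻¹ i j *
    (pderiv i (pderiv j φ) p - ∑ k, christoffel g k i j p * pderiv k φ p)

/-- Pullback `Φ^* g` of a field of bilinear forms under the coordinate map `Φ`. -/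
def pullback (Φ : (ι → ℝ) → (ι → ℝ)) (g : (ι → ℝ) → Matrix ι ι ℝ) (p : ι → ℝ) :
    Matrix ι ι ℝ :=
  Matrix.of fun a b =>
    ∑ c, ∑ d, pderiv a (fun q => Φ q c) p * pderiv b (fun q => Φ q d) p * g (Φ p) c d

end Calculus

/-- A symmetric bilinear form of signature `(-,+,…,+)`. -/
def IsLorentzian {n : ℕ} (G : Matrix (Fin (n + 1)) (Fin (n + 1)) ℝ) : Prop :=
  ∃ P : Matrix (Fin (n + 1)) (Fin (n + 1)) ℝ, IsUnit P.det ∧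
    Pᵀ * G * P = Matrix.diagonal (fun a => if a = 0 then (-1 : ℝ) else 1)

/-- `g` is a smooth Lorentzian metric on `D`. -/
structure IsMetricOn {n : ℕ} (D : Set (Fin (n + 1) → ℝ))
    (g : (Fin (n + 1) → ℝ) → Matrix (Fin (n + 1)) (Fin (n + 1)) ℝ) : Prop where
  smooth : ∀ a b, ContDiffOn ℝ ∞ (fun p => g p a b) D
  lorentzian : ∀ p ∈ D, IsLorentzian (g p)

/-- `g` solves the vacuum Einstein equations on `D` with cosmological constant `Λ`:
`R_{ab} = (2 / (N - 2)) Λ g_{ab}`, where `N = n + 1` is the space-time dimension. -/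
structure IsVacuumSolution {n : ℕ} (Λ : ℝ) (D : Set (Fin (n + 1) → ℝ))
    (g : (Fin (n + 1) → ℝ) → Matrix (Fin (n + 1)) (Fin (n + 1)) ℝ) : Prop where
  metric : IsMetricOn D g
  vacuum : ∀ p ∈ D, ∀ a b,
    ricci g p a b = 2 / (((n + 1 : ℕ) : ℝ) - 2) * g p a b * Λ

/-- `(g, φ)` solves the minimally coupled Einstein-scalar field equations on `D` with
effective potential `W`:
`R_{ab} = κ (∂ₐφ ∂_bφ + (2 / (N - 2)) g_{ab} W(φ))` and `□φ - W'(φ) = 0`, `N = n + 1`. -/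
structure IsEinsteinScalarSolution {n : ℕ} (κ : ℝ) (W : ℝ → ℝ)
    (D : Set (Fin (n + 1) → ℝ))
    (g : (Fin (n + 1) → ℝ) → Matrix (Fin (n + 1)) (Fin (n + 1)) ℝ)
    (φ : (Fin (n + 1) → ℝ) → ℝ) : Prop where
  metric : IsMetricOn D g
  field_smooth : ContDiffOn ℝ ∞ φ D
  einstein : ∀ p ∈ D, ∀ a b,
    ricci g p a b
      = κ * (pderiv a φ p * pderiv b φ p
          + 2 / (((n + 1 : ℕ) : ℝ) - 2) * g p a b * W (φ p))
  scalar : ∀ p ∈ D, box g φ p - deriv W (φ p) = 0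

/-! ## Orthogonal-symmetric geometries

Space-time points are `p : Fin (n + 1) → ℝ`, with `y = p 0` and `x = Fin.tail p`. -/

/-- The form `a dy² + B_{ij} dxⁱ dxʲ`. -/
def blockForm {n : ℕ} (a : ℝ) (B : Matrix (Fin n) (Fin n) ℝ) :
    Matrix (Fin (n + 1)) (Fin (n + 1)) ℝ :=
  Matrix.of (Fin.cons (Fin.cons a fun _ => 0) fun i => Fin.cons 0 fun j => B i j)

/-- The orthogonal-symmetric metric
`g[U, h] = ε e^{2U(x)} dy² + e^{-2U(x)} h_{ij}(x) dxⁱ dxʲ`. -/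
def orthMetric {n : ℕ} (ε : ℝ) (U : (Fin n → ℝ) → ℝ)
    (h : (Fin n → ℝ) → Matrix (Fin n) (Fin n) ℝ) (p : Fin (n + 1) → ℝ) :
    Matrix (Fin (n + 1)) (Fin (n + 1)) ℝ :=
  blockForm (ε * Real.exp (2 * U (Fin.tail p)))
    (Real.exp (-2 * U (Fin.tail p)) • h (Fin.tail p))

/-- The coordinate domain `{(y, x) | y ∈ I, x ∈ Ω}`. -/
def domain {n : ℕ} (I : Set ℝ) (Ω : Set (Fin n → ℝ)) : Set (Fin (n + 1) → ℝ) :=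
  {p | p 0 ∈ I ∧ Fin.tail p ∈ Ω}

/-- An orthogonal-symmetric vacuum seed `ĝ = g[V, ĥ]` with cosmological constant `Λ`, on a
connected coordinate patch `Ω` of the hypersurfaces orthogonal to the Killing field `∂/∂y`. -/
structure IsSeed {n : ℕ} (ε Λ : ℝ) (Ω : Set (Fin n → ℝ)) (V : (Fin n → ℝ) → ℝ)
    (h : (Fin n → ℝ) → Matrix (Fin n) (Fin n) ℝ) : Prop where
  isOpen : IsOpen Ω
  connected : IsConnected Ω
  smooth_potential : ContDiffOn ℝ ∞ V Ω
  smooth_metric : ∀ i j, ContDiffOn ℝ ∞ (fun x => h x i j) Ω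
  vacuum : IsVacuumSolution Λ (domain Set.univ Ω) (orthMetric ε V h)

/-- The data of the solution template
`e^{2μ(y)} (ε e^{2αV} dy² + e^{-2αV} e^{-2δV} ĥ_{ij} dxⁱ dxʲ)`, `φ = σ V(x) + ρ μ(y)`. -/
structure Template where
  α : ℝ
  δ : ℝ
  σ : ℝ
  ρ : ℝ
  μ : ℝ → ℝ

/-- The conformally `y`-inflated metric of the template: `e^{2μ(y)} g[αV, e^{-2δV} ĥ]`. -/
def Template.metric {n : ℕ} (T : Template) (ε : ℝ) (V : (Fin n → ℝ) → ℝ)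
    (h : (Fin n → ℝ) → Matrix (Fin n) (Fin n) ℝ) (p : Fin (n + 1) → ℝ) :
    Matrix (Fin (n + 1)) (Fin (n + 1)) ℝ :=
  Real.exp (2 * T.μ (p 0)) •
    orthMetric ε (fun x => T.α * V x) (fun x => Real.exp (-2 * (T.δ * V x)) • h x) p

/-- The scalar field of the template. -/
def Template.field {n : ℕ} (T : Template) (V : (Fin n → ℝ) → ℝ) (p : Fin (n + 1) → ℝ) : ℝ :=
  T.σ * V (Fin.tail p) + T.ρ * T.μ (p 0)

/-- The conformal weight that makes the template a solution transformation in dimension `N`: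
`δ = (N - 4) / (N - 3) * (1 - α)`. -/
def Template.IsTransformation (N : ℕ) (T : Template) : Prop :=
  T.δ = ((N : ℝ) - 4) / ((N : ℝ) - 3) * (1 - T.α)

/-- The template `T`, applied to the vacuum seed `g[V, ĥ]` with `Λ ≠ 0`, gives a `y`-dependent
(`μ` not constant) Einstein-scalar field solution with potential `W` on `I × Ω`: a solution
of class `𝒯_N^Λ`, `N = n + 1`. -/
structure IsClassTLambda {n : ℕ} (ε κ : ℝ) (W : ℝ → ℝ) (Λ : ℝ) (Ω : Set (Fin n → ℝ))
    (V : (Fin n → ℝ) → ℝ) (h : (Fin n → ℝ) → Matrix (Fin n) (Fin n) ℝ)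
    (I : Set ℝ) (T : Template) : Prop where
  seed : IsSeed ε Λ Ω V h
  cosm_ne_zero : Λ ≠ 0
  isOpen : IsOpen I
  connected : IsConnected I
  smooth : ContDiffOn ℝ ∞ T.μ I
  not_const : ∃ y₁ ∈ I, ∃ y₂ ∈ I, T.μ y₁ ≠ T.μ y₂
  solution : IsEinsteinScalarSolution κ W (domain I Ω) (T.metric ε V h) (T.field V)

/-! ## The one-parameter family -/

/-- `Λ = -(ε / 2) (N - 2)³ / (N - 1) χ`. -/
def familyCosm (N : ℕ) (ε χ : ℝ) : ℝ :=
  -(ε / 2) * (((N : ℝ) - 2) ^ 3 / ((N : ℝ) - 1)) * χ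

/-- `α = 1 / (N - 2)`. -/
def familyAlpha (N : ℕ) : ℝ := 1 / ((N : ℝ) - 2)

/-- `γ = α + (N - 4) / (N - 3) (1 - α)`. -/
def familyGamma (N : ℕ) : ℝ :=
  familyAlpha N + ((N : ℝ) - 4) / ((N : ℝ) - 3) * (1 - familyAlpha N)

/-- `ε e^{2(αV + √(-χ) y)} dy² + e^{-2γV + 2√(-χ) y} ĥ_{ij} dxⁱ dxʲ`, `N = n + 1`. -/
def familyMetric {n : ℕ} (ε χ : ℝ) (V : (Fin n → ℝ) → ℝ)
    (h : (Fin n → ℝ) → Matrix (Fin n) (Fin n) ℝ) (p : Fin (n + 1) → ℝ) :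
    Matrix (Fin (n + 1)) (Fin (n + 1)) ℝ :=
  blockForm
    (ε * Real.exp (2 * (familyAlpha (n + 1) * V (Fin.tail p) + √(-χ) * p 0)))
    (Real.exp (-2 * familyGamma (n + 1) * V (Fin.tail p) + 2 * √(-χ) * p 0) • h (Fin.tail p))

/-- `φ = e √((N - 1) / (κ (N - 2))) (V + (N - 2) / (N - 1) √(-χ) y)`, `e = ±1`, `N = n + 1`. -/
def familyField {n : ℕ} (κ e χ : ℝ) (V : (Fin n → ℝ) → ℝ) (p : Fin (n + 1) → ℝ) : ℝ :=
  e * √((((n + 1 : ℕ) : ℝ) - 1) / (κ * (((n + 1 : ℕ) : ℝ) - 2))) *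
    (V (Fin.tail p)
      + (((n + 1 : ℕ) : ℝ) - 2) / (((n + 1 : ℕ) : ℝ) - 1) * √(-χ) * p 0)

/-- The change of coordinate `Y = s (y - y₀)`. -/
def reparam {n : ℕ} (s y₀ : ℝ) (p : Fin (n + 1) → ℝ) : Fin (n + 1) → ℝ :=
  Fin.cons (s * (p 0 - y₀)) (Fin.tail p)

/-- `lam = e / √(N - 1)` and the template `T` has the parameter values of the family
for this `lam`:
`α = e lam / √(N - 3 + lam²) = 1 / (N - 2)`, `δ = (N - 4) / (N - 3) (1 - α)`,
`σ = e √((N - 2) / (κ (N - 3 + lam²)))`, `ρ = √((N - 2) / κ) lam`. -/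
structure HasFamilyParameters (N : ℕ) (κ e lam : ℝ) (T : Template) : Prop where
  lam_eq : lam = e / √((N : ℝ) - 1)
  alpha_eq : T.α = e * (lam / √((N : ℝ) - 3 + lam ^ 2))
  alpha_eq_family : T.α = familyAlpha N
  delta_eq : T.δ = ((N : ℝ) - 4) / ((N : ℝ) - 3) * (1 - T.α)
  sigma_eq : T.σ = e * √(((N : ℝ) - 2) / (κ * ((N : ℝ) - 3 + lam ^ 2)))
  rho_eq : T.ρ = √(((N : ℝ) - 2) / κ) * lam

/-- On `I`, and for seeds with cosmological constant `Λ`, the template `T` is the member `χ`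
of the family (in dimension `N = n + 1`), up to a reflection and a translation of the
coordinate `y` along the Killing field of the seed. -/
def IsFamilyMember (n : ℕ) (ε κ Λ : ℝ) (I : Set ℝ) (T : Template) (χ : ℝ) : Prop :=
  χ < 0 ∧ Λ = familyCosm (n + 1) ε χ ∧
  ∃ e s y₀ lam : ℝ, (e = 1 ∨ e = -1) ∧ (s = 1 ∨ s = -1) ∧
    HasFamilyParameters (n + 1) κ e lam T ∧
    (∀ y ∈ I, T.μ y = √(-χ) * (s * (y - y₀))) ∧
    ∀ (V : (Fin n → ℝ) → ℝ) (h : (Fin n → ℝ) → Matrix (Fin n) (Fin n) ℝ)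
      (p : Fin (n + 1) → ℝ), p 0 ∈ I →
      T.metric ε V h p = pullback (reparam s y₀) (familyMetric ε χ V h) p ∧
      T.field V p = familyField κ e χ V (reparam s y₀ p)

end EinsteinScalar

end

noncomputable section

set_option linter.unusedSectionVars false

namespace EinsteinScalar

/-! ### Tensor calculus for nondegenerate symmetric forms of any signature. -/

section TensorCalculus

variable {ι : Type*} [Fintype ι] [DecidableEq ι]

/-! Write n = N - 1, q = e^{-4V} ĥ and K = 2Λ/(N - 2). Every template metric equals e^{2(αV + μ)} (ε
dy² + e^{2τV} q) with τ = 2 - 2α - δ, and the seed is the case α = 1, τ = 0, μ = 0. Hence the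
conformal change of the Ricci tensor (`RegularOn.ricci_conformal`), applied once to q and once to a
product metric, computes both. For the seed it gives □V + (n-1)|∇V|² = -K e^{2V} and Ric(q) =
(n-1)(∇∇V - dV dV), all with respect to q (`vacuum_iff`). These eliminate □V and Ric(q) from the
field equations of the template, which become the pointwise system of `Template.solution_iff`. There
∇∇V survives only with the coefficient -β, where β = (n-2)τ + (n-1)α - (n-1), and β = 0 is exactly
the prescribed value of δ.

Part (1) is then substitution.

Part (2). If β = 0, the spatial equation says that a multiple of dV ⊗ dV equals a multiple of q.
Since q is nondegenerate in dimension n ≥ 3, the multiple of q vanishes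
(`RegularOn.eq_zero_of_rank_one`), so ε(μ'' + (n-1)μ'²) = (τ + α) K e^{2(1-τ)V}. The yy equation
also equates a multiple of e^{2(1-τ)V} to a function of y. As Λ ≠ 0, V is not constant; so τ ≠ 1
would force α = 0 and τ = 0, against β = 0. Thus τ = 1, which fixes α and δ; the remaining equations
give κσρ = 1 and κσ² = n/(n-1), hence ρ. Eliminating μ'' shows that μ'² is a positive constant,
which is -χ.

Part (3). It suffices to derive β = 0. The test seeds are planar Schwarzschild–de Sitter metrics
whose lapse takes a prescribed value f > 0 at a point. In a planar direction there, dV vanishes, and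
the spatial equation becomes a polynomial of degree two in f; its vanishing at f = 1, 2, 3 forces β
= 0. The same seeds give the existence statement in (1). -/

theorem pderiv_congr {f g : (ι → ℝ) → ℝ} {D : Set (ι → ℝ)} (hD : IsOpen D) {p : ι → ℝ}
    (hp : p ∈ D) (h : ∀ q ∈ D, f q = g q) (i : ι) : pderiv i f p = pderiv i g p := by
  have : f =ᶠ[nhds p] g := Filter.eventually_of_mem (hD.mem_nhds hp) h
  simp only [pderiv, this.fderiv_eq]

theorem pderiv_const (i : ι) (a : ℝ) (p : ι → ℝ) : pderiv i (fun _ => a) p = 0 := by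
  simp [pderiv]

theorem pderiv_add {f g : (ι → ℝ) → ℝ} {p : ι → ℝ} (hf : DifferentiableAt ℝ f p)
    (hg : DifferentiableAt ℝ g p) (i : ι) :
    pderiv i (fun q => f q + g q) p = pderiv i f p + pderiv i g p := by
  simp only [pderiv, fderiv_fun_add hf hg]; rfl

theorem pderiv_sub {f g : (ι → ℝ) → ℝ} {p : ι → ℝ} (hf : DifferentiableAt ℝ f p)
    (hg : DifferentiableAt ℝ g p) (i : ι) :
    pderiv i (fun q => f q - g q) p = pderiv i f p - pderiv i g p := by
  simp only [pderiv, fderiv_fun_sub hf hg]; rfl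

theorem pderiv_mul {f g : (ι → ℝ) → ℝ} {p : ι → ℝ} (hf : DifferentiableAt ℝ f p)
    (hg : DifferentiableAt ℝ g p) (i : ι) :
    pderiv i (fun q => f q * g q) p = f p * pderiv i g p + pderiv i f p * g p := by
  simp only [pderiv, fderiv_fun_mul hf hg]; simp; ring

theorem pderiv_const_mul (a : ℝ) (f : (ι → ℝ) → ℝ) (p : ι → ℝ) (i : ι) :
    pderiv i (fun q => a * f q) p = a * pderiv i f p := by
  have h : (fun q => a * f q) = a • f := rfl
  simp only [pderiv, h, fderiv_const_smul_field]; rfl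

theorem pderiv_sum {κ : Type*} (s : Finset κ) {f : κ → (ι → ℝ) → ℝ} {p : ι → ℝ}
    (hf : ∀ k ∈ s, DifferentiableAt ℝ (f k) p) (i : ι) :
    pderiv i (fun q => ∑ k ∈ s, f k q) p = ∑ k ∈ s, pderiv i (f k) p := by
  simp only [pderiv, fderiv_fun_sum hf]; simp

theorem pderiv_exp {f : (ι → ℝ) → ℝ} {p : ι → ℝ} (hf : DifferentiableAt ℝ f p) (i : ι) :
    pderiv i (fun q => Real.exp (f q)) p = Real.exp (f p) * pderiv i f p := by
  simp only [pderiv, fderiv_exp hf]; simp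

theorem contDiffOn_pderiv {f : (ι → ℝ) → ℝ} {D : Set (ι → ℝ)} (hD : IsOpen D)
    (hf : ContDiffOn ℝ ∞ f D) (i : ι) : ContDiffOn ℝ ∞ (pderiv i f) D :=
  (hf.fderiv_of_isOpen hD (m := ∞) (by simp)).clm_apply contDiffOn_const

theorem _root_.ContDiffOn.diffAt {f : (ι → ℝ) → ℝ} {D : Set (ι → ℝ)}
    (hf : ContDiffOn ℝ ∞ f D) (hD : IsOpen D) {p : ι → ℝ} (hp : p ∈ D) :
    DifferentiableAt ℝ f p :=
  (hf.contDiffAt (hD.mem_nhds hp)).differentiableAt (by simp)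

theorem pderiv_comm {f : (ι → ℝ) → ℝ} {D : Set (ι → ℝ)} (hD : IsOpen D)
    (hf : ContDiffOn ℝ ∞ f D) {p : ι → ℝ} (hp : p ∈ D) (i j : ι) :
    pderiv i (pderiv j f) p = pderiv j (pderiv i f) p := by
  have hs : IsSymmSndFDerivAt ℝ f p :=
    (hf.contDiffAt (hD.mem_nhds hp)).isSymmSndFDerivAt (by
      rw [minSmoothness_of_isRCLikeNormedField]; 
      exact WithTop.coe_le_coe.2 (le_top : (2 : ℕ∞) ≤ ⊤))
  have hd : DifferentiableAt ℝ (fderiv ℝ f) p :=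
    ((hf.fderiv_of_isOpen hD (m := ∞) (by simp)).contDiffAt (hD.mem_nhds hp)).differentiableAt
      (by simp)
  have key : ∀ a b : ι, pderiv a (pderiv b f) p
      = fderiv ℝ (fderiv ℝ f) p (Pi.single a 1) (Pi.single b 1) := by
    intro a b
    have := fderiv_clm_apply hd (differentiableAt_const (Pi.single b (1 : ℝ)))
    simp only [pderiv]
    unfold pderiv
    rw [this]; simp
  rw [key, key, hs]

/-- A smooth field of nondegenerate symmetric bilinear forms on `D`. -/
structure RegularOn (D : Set (ι → ℝ)) (g : (ι → ℝ) → Matrix ι ι ℝ) : Prop where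
  smooth : ∀ i j, ContDiffOn ℝ ∞ (fun p => g p i j) D
  symm : ∀ p ∈ D, ∀ i j, g p i j = g p j i
  nondeg : ∀ p ∈ D, IsUnit (g p).det

/-- The covariant Hessian `∇ᵢ∇ⱼφ`. -/
def hess (g : (ι → ℝ) → Matrix ι ι ℝ) (φ : (ι → ℝ) → ℝ) (p : ι → ℝ) (i j : ι) : ℝ :=
  pderiv i (pderiv j φ) p - ∑ k, christoffel g k i j p * pderiv k φ p

/-- The gradient `∇ᵏφ`. -/
def grad (g : (ι → ℝ) → Matrix ι ι ℝ) (φ : (ι → ℝ) → ℝ) (k : ι) (p : ι → ℝ) : ℝ :=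
  ∑ l, (g p)⁻¹ k l * pderiv l φ p

/-- The inner product `⟨∇φ, ∇ψ⟩`. -/
def gradInner (g : (ι → ℝ) → Matrix ι ι ℝ) (φ ψ : (ι → ℝ) → ℝ) (p : ι → ℝ) : ℝ :=
  ∑ k, pderiv k φ p * grad g ψ k p

theorem box_eq_sum_hess (g : (ι → ℝ) → Matrix ι ι ℝ) (φ : (ι → ℝ) → ℝ) (p : ι → ℝ) :
    box g φ p = ∑ i, ∑ j, (g p)⁻¹ i j * hess g φ p i j := rfl

namespace RegularOn

variable {D : Set (ι → ℝ)} {g : (ι → ℝ) → Matrix ι ι ℝ}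

theorem diff (hg : RegularOn D g) (hD : IsOpen D) {p : ι → ℝ} (hp : p ∈ D) (i j : ι) :
    DifferentiableAt ℝ (fun p => g p i j) p := (hg.smooth i j).diffAt hD hp

theorem sum_inv_mul (hg : RegularOn D g) {p : ι → ℝ} (hp : p ∈ D) (i j : ι) :
    ∑ k, (g p)⁻¹ i k * g p k j = if i = j then 1 else 0 := by
  have := congrFun (congrFun (Matrix.nonsing_inv_mul (g p) (hg.nondeg p hp)) i) j
  rwa [Matrix.mul_apply, Matrix.one_apply] at this

theorem sum_mul_inv (hg : RegularOn D g) {p : ι → ℝ} (hp : p ∈ D) (i j : ι) :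
    ∑ k, g p i k * (g p)⁻¹ k j = if i = j then 1 else 0 := by
  have := congrFun (congrFun (Matrix.mul_nonsing_inv (g p) (hg.nondeg p hp)) i) j
  rwa [Matrix.mul_apply, Matrix.one_apply] at this

theorem inv_symm (hg : RegularOn D g) {p : ι → ℝ} (hp : p ∈ D) (i j : ι) :
    (g p)⁻¹ i j = (g p)⁻¹ j i := by
  have h : (g p)ᵀ = g p := by ext a b; exact hg.symm p hp b a
  have := congrFun (congrFun (Matrix.transpose_nonsing_inv (g p)) j) i
  rw [h] at this; exact this

theorem smooth_det {κ : Type*} [Fintype κ] [DecidableEq κ] {D : Set (ι → ℝ)}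
    {A : (ι → ℝ) → Matrix κ κ ℝ}
    (hA : ∀ i j, ContDiffOn ℝ ∞ (fun p => A p i j) D) :
    ContDiffOn ℝ ∞ (fun p => (A p).det) D := by
  simp only [Matrix.det_apply]
  refine ContDiffOn.sum fun σ _ => ContDiffOn.const_smul _ ?_
  exact contDiffOn_prod fun i _ => hA _ _

/-- Cramer's rule: an entry of the inverse is a cofactor divided by the determinant, both polynomial
in the entries of g. -/
theorem smooth_inv (hg : RegularOn D g) (i j : ι) :
    ContDiffOn ℝ ∞ (fun p => (g p)⁻¹ i j) D := by
  have hdet := smooth_det hg.smooth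
  have hadj : ContDiffOn ℝ ∞ (fun p => (g p).adjugate i j) D := by
    simp only [Matrix.adjugate_apply]
    refine smooth_det fun a b => ?_
    by_cases h : a = j
    · subst h; simpa using contDiffOn_const
    · simpa [Matrix.updateRow_ne h] using hg.smooth a b
  have : ∀ p ∈ D, (g p)⁻¹ i j = ((g p).det)⁻¹ * (g p).adjugate i j := by
    intro p _
    simp [Matrix.inv_def]
  refine ContDiffOn.congr (ContDiffOn.mul (hdet.inv fun p hp => (hg.nondeg p hp).ne_zero) hadj) this

theorem smooth_christoffel (hg : RegularOn D g) (hD : IsOpen D) (k i j : ι) :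
    ContDiffOn ℝ ∞ (christoffel g k i j) D := by
  unfold christoffel
  refine contDiffOn_const.mul (ContDiffOn.sum fun l _ => (hg.smooth_inv k l).mul ?_)
  exact ((contDiffOn_pderiv hD (hg.smooth _ _) _).add (contDiffOn_pderiv hD (hg.smooth _ _) _)).sub
    (contDiffOn_pderiv hD (hg.smooth _ _) _)

theorem smooth_grad (hg : RegularOn D g) (hD : IsOpen D) {φ : (ι → ℝ) → ℝ}
    (hφ : ContDiffOn ℝ ∞ φ D) (k : ι) : ContDiffOn ℝ ∞ (grad g φ k) D :=
  ContDiffOn.sum fun l _ => (hg.smooth_inv k l).mul (contDiffOn_pderiv hD hφ _)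

theorem pderiv_symm (hg : RegularOn D g) (hD : IsOpen D) {p : ι → ℝ} (hp : p ∈ D) (k i j : ι) :
    pderiv k (fun q => g q i j) p = pderiv k (fun q => g q j i) p :=
  pderiv_congr hD hp (fun q hq => hg.symm q hq i j) k

theorem christoffel_symm (hg : RegularOn D g) (hD : IsOpen D) {p : ι → ℝ} (hp : p ∈ D)
    (k i j : ι) : christoffel g k i j p = christoffel g k j i p := by
  unfold christoffel
  congr 1
  refine Finset.sum_congr rfl fun l _ => ?_
  rw [hg.pderiv_symm hD hp l i j]; ring

theorem sum_mul_sum_inv (hg : RegularOn D g) {p : ι → ℝ} (hp : p ∈ D) (a : ι) (X : ι → ℝ) :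
    ∑ l, g p a l * ∑ m, (g p)⁻¹ l m * X m = X a := by
  simp only [Finset.mul_sum]
  rw [Finset.sum_comm]
  simp only [← mul_assoc, ← Finset.sum_mul, hg.sum_mul_inv hp]
  simp

theorem sum_inv_mul_sum (hg : RegularOn D g) {p : ι → ℝ} (hp : p ∈ D) (a : ι) (X : ι → ℝ) :
    ∑ l, (g p)⁻¹ a l * ∑ m, g p l m * X m = X a := by
  simp only [Finset.mul_sum]
  rw [Finset.sum_comm]
  simp only [← mul_assoc, ← Finset.sum_mul, hg.sum_inv_mul hp]
  simp

theorem lower_christoffel (hg : RegularOn D g) {p : ι → ℝ} (hp : p ∈ D) (a i j : ι) :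
    ∑ l, g p a l * christoffel g l i j p
      = (1 / 2) * (pderiv i (fun q => g q j a) p + pderiv j (fun q => g q i a) p
          - pderiv a (fun q => g q i j) p) := by
  unfold christoffel
  simp only [mul_left_comm _ (1 / 2 : ℝ), ← Finset.mul_sum]
  rw [hg.sum_mul_sum_inv hp]

/-- Metric compatibility ∇g = 0, solved for the partial derivative of g. -/
theorem pderiv_metric (hg : RegularOn D g) (hD : IsOpen D) {p : ι → ℝ} (hp : p ∈ D) (k i j : ι) :
    pderiv k (fun q => g q i j) p
      = ∑ l, g p i l * christoffel g l k j p + ∑ l, g p j l * christoffel g l k i p := by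
  rw [hg.lower_christoffel hp, hg.lower_christoffel hp, hg.pderiv_symm hD hp k j i,
    hg.pderiv_symm hD hp j k i, hg.pderiv_symm hD hp i k j]
  rw [hg.pderiv_symm hD hp i j k]
  ring

theorem sum_mul_grad (hg : RegularOn D g) {p : ι → ℝ} (hp : p ∈ D) (φ : (ι → ℝ) → ℝ) (a : ι) :
    ∑ l, g p a l * grad g φ l p = pderiv a φ p := hg.sum_mul_sum_inv hp a _

theorem gradInner_comm (hg : RegularOn D g) {p : ι → ℝ} (hp : p ∈ D) (φ ψ : (ι → ℝ) → ℝ) :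
    gradInner g φ ψ p = gradInner g ψ φ p := by
  simp only [gradInner, grad, Finset.mul_sum]
  rw [Finset.sum_comm]
  refine Finset.sum_congr rfl fun i _ => Finset.sum_congr rfl fun j _ => ?_
  rw [hg.inv_symm hp j i]; ring

/-- The product rule applied to ∂ₐφ = g_{ab} ∇ᵇφ. It exchanges second derivatives of φ for first
derivatives of the gradient, the form in which they arise from differentiating Christoffel symbols.
-/
theorem pderiv_pderiv (hg : RegularOn D g) (hD : IsOpen D) {φ : (ι → ℝ) → ℝ}
    (hφ : ContDiffOn ℝ ∞ φ D) {p : ι → ℝ} (hp : p ∈ D) (i a : ι) :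
    pderiv i (pderiv a φ) p = ∑ b, g p a b * pderiv i (grad g φ b) p
      + ∑ b, pderiv i (fun q => g q a b) p * grad g φ b p := by
  have e : ∀ q ∈ D, pderiv a φ q = ∑ b, g q a b * grad g φ b q :=
    fun q hq => (hg.sum_mul_grad hq φ a).symm
  rw [pderiv_congr hD hp e, pderiv_sum, ← Finset.sum_add_distrib]
  · exact Finset.sum_congr rfl fun b _ => pderiv_mul (hg.diff hD hp a b)
      ((hg.smooth_grad hD hφ b).diffAt hD hp) i
  · exact fun b _ => (hg.diff hD hp a b).mul ((hg.smooth_grad hD hφ b).diffAt hD hp)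

/-- `□φ` is the divergence of the gradient. -/
theorem box_eq_div_grad (hg : RegularOn D g) (hD : IsOpen D) {φ : (ι → ℝ) → ℝ}
    (hφ : ContDiffOn ℝ ∞ φ D) {p : ι → ℝ} (hp : p ∈ D) :
    box g φ p = ∑ k, pderiv k (grad g φ k) p
      + ∑ l, (∑ k, christoffel g k k l p) * grad g φ l p := by
  -- The Hessian is the covariant derivative of the gradient with its index lowered; tracing with
  -- the inverse metric then cancels the factor g.
  have h2 : ∀ i a, hess g φ p i a = ∑ b, g p a b * pderiv i (grad g φ b) p
      + ∑ l, g p a l * ∑ b, christoffel g l i b p * grad g φ b p := by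
    intro i a
    rw [hess, hg.pderiv_pderiv hD hφ hp, add_sub_assoc]
    congr 1
    have e3 : ∑ k, christoffel g k i a p * pderiv k φ p
        = ∑ b, (∑ l, g p b l * christoffel g l i a p) * grad g φ b p := by
      simp only [← hg.sum_mul_grad hp φ, Finset.mul_sum, Finset.sum_mul]
      rw [Finset.sum_comm]
      refine Finset.sum_congr rfl fun b _ => Finset.sum_congr rfl fun l _ => ?_
      rw [hg.symm p hp l b]; ring
    have e4 : ∑ l, g p a l * ∑ b, christoffel g l i b p * grad g φ b p
        = ∑ b, (∑ l, g p a l * christoffel g l i b p) * grad g φ b p := by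
      simp only [Finset.mul_sum, Finset.sum_mul]
      rw [Finset.sum_comm]
      exact Finset.sum_congr rfl fun b _ => Finset.sum_congr rfl fun l _ => by ring
    rw [e3, e4, ← Finset.sum_sub_distrib]
    refine Finset.sum_congr rfl fun b _ => ?_
    rw [hg.pderiv_metric hD hp]; ring
  rw [box_eq_sum_hess]
  simp only [h2, mul_add, Finset.sum_add_distrib, hg.sum_inv_mul_sum hp]
  congr 1
  rw [Finset.sum_comm]
  simp only [Finset.sum_mul]

end RegularOn

end TensorCalculus

/-! ### Conformal rescaling of connection, Hessian and curvature. -/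

section Conformal

variable {ι : Type*} [Fintype ι] [DecidableEq ι]

/-- The conformally rescaled metric `e^{2w} g`. -/
def conformal (w : (ι → ℝ) → ℝ) (g : (ι → ℝ) → Matrix ι ι ℝ) (p : ι → ℝ) : Matrix ι ι ℝ :=
  Real.exp (2 * w p) • g p

namespace RegularOn

variable {D : Set (ι → ℝ)} {g : (ι → ℝ) → Matrix ι ι ℝ} {w : (ι → ℝ) → ℝ}

theorem conformal_inv (hg : RegularOn D g) {p : ι → ℝ} (hp : p ∈ D) (i j : ι) :
    (conformal w g p)⁻¹ i j = (Real.exp (2 * w p))⁻¹ * (g p)⁻¹ i j := by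
  have : (conformal w g p)⁻¹ = (Real.exp (2 * w p))⁻¹ • (g p)⁻¹ := by
    apply Matrix.inv_eq_left_inv
    rw [conformal, smul_mul_smul_comm, inv_mul_cancel₀ (Real.exp_ne_zero _),
      Matrix.nonsing_inv_mul _ (hg.nondeg p hp), one_smul]
  rw [this]; rfl

theorem conformal_metric (hg : RegularOn D g) (hw : ContDiffOn ℝ ∞ w D) :
    RegularOn D (conformal w g) where
  smooth i j := (contDiffOn_const.mul hw).exp.mul (hg.smooth i j)
  symm p hp i j := by simp [conformal, hg.symm p hp i j]
  nondeg p hp := by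
    rw [conformal, Matrix.det_smul]
    exact ((Real.exp_ne_zero _).isUnit.pow _).mul (hg.nondeg p hp)

theorem pderiv_conformal (hg : RegularOn D g) (hD : IsOpen D) (hw : ContDiffOn ℝ ∞ w D)
    {p : ι → ℝ} (hp : p ∈ D) (k i j : ι) :
    pderiv k (fun q => conformal w g q i j) p
      = Real.exp (2 * w p) * (2 * pderiv k w p * g p i j + pderiv k (fun q => g q i j) p) := by
  have hd := hw.diffAt hD hp
  have : (fun q => conformal w g q i j) = fun q => Real.exp (2 * w q) * g q i j := by
    ext q; simp [conformal]
  rw [this, pderiv_mul (hd.const_mul 2).exp (hg.diff hD hp i j), pderiv_exp (hd.const_mul 2),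
    pderiv_const_mul]
  ring

/-- The change of the Christoffel symbols under a conformal rescaling. -/
theorem christoffel_conformal (hg : RegularOn D g) (hD : IsOpen D) (hw : ContDiffOn ℝ ∞ w D)
    {p : ι → ℝ} (hp : p ∈ D) (k i j : ι) :
    christoffel (conformal w g) k i j p = christoffel g k i j p
      + ((if k = i then 1 else 0) * pderiv j w p + (if k = j then 1 else 0) * pderiv i w p
        - g p i j * grad g w k p) := by
  have e : ∀ l, (conformal w g p)⁻¹ k l *
      (pderiv i (fun q => conformal w g q j l) p + pderiv j (fun q => conformal w g q i l) p
        - pderiv l (fun q => conformal w g q i j) p)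
      = (g p)⁻¹ k l * (pderiv i (fun q => g q j l) p + pderiv j (fun q => g q i l) p
        - pderiv l (fun q => g q i j) p)
        + 2 * (((g p)⁻¹ k l * g p l j) * pderiv i w p + ((g p)⁻¹ k l * g p l i) * pderiv j w p
          - g p i j * ((g p)⁻¹ k l * pderiv l w p)) := by
    intro l
    rw [hg.conformal_inv hp, hg.pderiv_conformal hD hw hp, hg.pderiv_conformal hD hw hp,
      hg.pderiv_conformal hD hw hp, hg.symm p hp j l, hg.symm p hp i l]
    field_simp [Real.exp_ne_zero]
    ring
  rw [christoffel, Finset.sum_congr rfl fun l _ => e l]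
  simp only [Finset.sum_add_distrib, ← Finset.mul_sum, Finset.sum_sub_distrib, ← Finset.sum_mul,
    hg.sum_inv_mul hp]
  rw [christoffel, grad]
  ring

theorem grad_conformal (hg : RegularOn D g) {p : ι → ℝ} (hp : p ∈ D) (φ : (ι → ℝ) → ℝ) (k : ι) :
    grad (conformal w g) φ k p = (Real.exp (2 * w p))⁻¹ * grad g φ k p := by
  simp only [grad, hg.conformal_inv hp, Finset.mul_sum, mul_assoc]

theorem gradInner_conformal (hg : RegularOn D g) {p : ι → ℝ} (hp : p ∈ D)
    (φ ψ : (ι → ℝ) → ℝ) :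
    gradInner (conformal w g) φ ψ p = (Real.exp (2 * w p))⁻¹ * gradInner g φ ψ p := by
  simp only [gradInner, hg.grad_conformal hp, Finset.mul_sum]
  exact Finset.sum_congr rfl fun b _ => by ring

theorem hess_conformal (hg : RegularOn D g) (hD : IsOpen D) (hw : ContDiffOn ℝ ∞ w D)
    {p : ι → ℝ} (hp : p ∈ D) (φ : (ι → ℝ) → ℝ) (i j : ι) :
    hess (conformal w g) φ p i j = hess g φ p i j
      - (pderiv i φ p * pderiv j w p + pderiv j φ p * pderiv i w p
        - g p i j * gradInner g φ w p) := by
  have : ∑ k, christoffel (conformal w g) k i j p * pderiv k φ p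
      = ∑ k, christoffel g k i j p * pderiv k φ p
        + (pderiv i φ p * pderiv j w p + pderiv j φ p * pderiv i w p
          - g p i j * gradInner g φ w p) := by
    simp only [hg.christoffel_conformal hD hw hp, add_mul, sub_mul, Finset.sum_add_distrib,
      Finset.sum_sub_distrib, gradInner, Finset.mul_sum, ite_mul, one_mul, zero_mul,
      Finset.sum_ite_eq', Finset.mem_univ, if_true]
    congr 1
    congr 1
    · ring
    · exact Finset.sum_congr rfl fun b _ => by ring
  rw [hess, hess, this]; ring

theorem sum_inv_metric (hg : RegularOn D g) {p : ι → ℝ} (hp : p ∈ D) :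
    ∑ i, ∑ j, (g p)⁻¹ i j * g p i j = Fintype.card ι := by
  have : ∀ i, ∑ j, (g p)⁻¹ i j * g p i j = 1 := by
    intro i
    simp_rw [hg.symm p hp i]
    rw [hg.sum_inv_mul hp]; simp
  simp [this]

theorem box_conformal (hg : RegularOn D g) (hD : IsOpen D) (hw : ContDiffOn ℝ ∞ w D)
    {p : ι → ℝ} (hp : p ∈ D) (φ : (ι → ℝ) → ℝ) :
    box (conformal w g) φ p = (Real.exp (2 * w p))⁻¹ *
      (box g φ p + ((Fintype.card ι : ℝ) - 2) * gradInner g φ w p) := by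
  have e : ∀ i j, (conformal w g p)⁻¹ i j * hess (conformal w g) φ p i j
      = (Real.exp (2 * w p))⁻¹ * ((g p)⁻¹ i j * hess g φ p i j
        - pderiv i φ p * ((g p)⁻¹ i j * pderiv j w p)
        - pderiv i w p * ((g p)⁻¹ i j * pderiv j φ p)
        + ((g p)⁻¹ i j * g p i j) * gradInner g φ w p) := by
    intro i j
    rw [hg.hess_conformal hD hw hp, hg.conformal_inv hp]; ring
  rw [box_eq_sum_hess, box_eq_sum_hess]
  simp only [e, ← Finset.mul_sum, Finset.sum_add_distrib, Finset.sum_sub_distrib, ← Finset.sum_mul,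
    hg.sum_inv_metric hp]
  congr 1
  have h1 : ∑ i, pderiv i φ p * ∑ j, (g p)⁻¹ i j * pderiv j w p = gradInner g φ w p := rfl
  have h2 : ∑ i, pderiv i w p * ∑ j, (g p)⁻¹ i j * pderiv j φ p = gradInner g φ w p :=
    hg.gradInner_comm hp w φ
  rw [h1, h2]; ring

/-- The quadratic part of the Ricci tensor after adding
`δᵏᵢ vⱼ + δᵏⱼ vᵢ - Gᵢⱼ Wᵏ` to the connection. -/
theorem _root_.EinsteinScalar.connection_quadratic (Γ : ι → ι → ι → ℝ) (v W : ι → ℝ)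
    (G : Matrix ι ι ℝ) (hΓ : ∀ k i j, Γ k i j = Γ k j i) (hG : ∀ i j, G i j = G j i)
    (hW : ∀ a, ∑ l, G a l * W l = v a) (C : ι → ι → ι → ℝ)
    (hC : ∀ k i j, C k i j = (if k = i then 1 else 0) * v j + (if k = j then 1 else 0) * v i
      - G i j * W k) (i j : ι) :
    ∑ k, ∑ l, ((Γ k k l + C k k l) * (Γ l i j + C l i j)
        - (Γ k j l + C k j l) * (Γ l i k + C l i k))
      = ∑ k, ∑ l, (Γ k k l * Γ l i j - Γ k j l * Γ l i k)
        - G i j * ∑ l, (∑ k, Γ k k l) * W l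
        + ((Fintype.card ι : ℝ) - 2) * ∑ l, Γ l i j * v l
        + ((Fintype.card ι : ℝ) - 2) * (v i * v j - G i j * ∑ l, v l * W l)
        + ∑ k, G i k * ∑ l, Γ k j l * W l + ∑ k, G j k * ∑ l, Γ k i l * W l := by
  -- Every sum over C reduces to contracting its upper index with some covector X, or to its trace,
  -- where v_l and -G_{kl} Wᵏ cancel.
  have contract : ∀ (X : ι → ℝ) a b,
      ∑ l, X l * C l a b = X a * v b + X b * v a - G a b * ∑ l, X l * W l := by
    intro X a b
    simp only [hC, mul_sub, mul_add, Finset.sum_sub_distrib, Finset.sum_add_distrib, ite_mul,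
      mul_ite, one_mul, zero_mul, mul_zero, Finset.sum_ite_eq', Finset.mem_univ, if_true,
      Finset.mul_sum]
    congr 1
    exact Finset.sum_congr rfl fun l _ => by ring
  have trace : ∀ l, ∑ k, C k k l = Fintype.card ι * v l := by
    intro l
    have : ∑ k, G k l * W k = v l := by simp_rw [hG _ l]; exact hW l
    simp only [hC, Finset.sum_sub_distrib, Finset.sum_add_distrib, ite_mul, one_mul, zero_mul,
      Finset.sum_ite_eq', Finset.mem_univ, if_true, this]
    simp
  have trace' : ∀ l, ∑ k, C k l k = Fintype.card ι * v l := by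
    intro l
    rw [← trace l]
    exact Finset.sum_congr rfl fun k _ => by rw [hC, hC, hG]; ring
  have A : ∑ k, ∑ l, (Γ k k l + C k k l) * (Γ l i j + C l i j)
      = ∑ k, ∑ l, Γ k k l * Γ l i j
        + ((∑ k, Γ k k i) * v j + (∑ k, Γ k k j) * v i - G i j * ∑ l, (∑ k, Γ k k l) * W l)
        + Fintype.card ι * ∑ l, Γ l i j * v l
        + Fintype.card ι * (v i * v j + v j * v i - G i j * ∑ l, v l * W l) := by
    rw [Finset.sum_comm, ← contract v i j, ← contract (fun l => ∑ k, Γ k k l) i j,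
      Finset.sum_comm (f := fun k l => Γ k k l * Γ l i j), Finset.mul_sum, Finset.mul_sum]
    simp only [← Finset.sum_add_distrib, ← Finset.sum_mul]
    refine Finset.sum_congr rfl fun l _ => ?_
    rw [Finset.sum_add_distrib, trace]; ring
  have B1 : ∑ k, ∑ l, Γ k j l * C l i k
      = ∑ l, Γ l i j * v l + (∑ k, Γ k k j) * v i - ∑ k, G i k * ∑ l, Γ k j l * W l := by
    simp only [contract, Finset.sum_add_distrib, Finset.sum_sub_distrib, Finset.sum_mul]
    simp only [hΓ _ j i, hΓ _ j _]
  have B2 : ∑ k, ∑ l, C k j l * Γ l i k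
      = ∑ l, Γ l i j * v l + (∑ k, Γ k k i) * v j - ∑ k, G j k * ∑ l, Γ k i l * W l := by
    rw [Finset.sum_comm]
    simp only [mul_comm (C _ _ _), contract, Finset.sum_add_distrib, Finset.sum_sub_distrib,
      Finset.sum_mul]
    congr 2
    exact Finset.sum_congr rfl fun k _ => by rw [hΓ]
  have B3 : ∑ k, ∑ l, C k j l * C l i k
      = (Fintype.card ι + 2) * (v i * v j) - 2 * (G i j * ∑ l, v l * W l) := by
    have h : ∀ k, ∑ l, C k j l * W l = if k = j then ∑ l, v l * W l else 0 := by
      intro k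
      have e : ∀ l, C k j l * W l = (if k = j then 1 else 0) * (v l * W l)
          + (if k = l then v j * W l else 0) - (G j l * W l) * W k := by
        intro l; rw [hC]; split_ifs <;> ring
      simp only [e, Finset.sum_sub_distrib, Finset.sum_add_distrib, ← Finset.mul_sum,
        ← Finset.sum_mul, hW, Finset.sum_ite_eq, Finset.mem_univ, if_true]
      split_ifs <;> ring
    simp only [contract, h, Finset.sum_add_distrib, Finset.sum_sub_distrib, ← Finset.sum_mul, trace']
    simp only [mul_comm (C _ _ _), contract, mul_ite, mul_zero, Finset.sum_ite_eq',
      Finset.mem_univ, if_true]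
    rw [hG j i]; ring
  have B : ∑ k, ∑ l, (Γ k j l + C k j l) * (Γ l i k + C l i k)
      = ∑ k, ∑ l, Γ k j l * Γ l i k + ∑ k, ∑ l, Γ k j l * C l i k
        + ∑ k, ∑ l, C k j l * Γ l i k + ∑ k, ∑ l, C k j l * C l i k := by
    simp only [← Finset.sum_add_distrib]
    exact Finset.sum_congr rfl fun k _ => Finset.sum_congr rfl fun l _ => by ring
  simp only [Finset.sum_sub_distrib]
  rw [A, B, B1, B2, B3]
  ring

/-- The change of the Ricci tensor under a conformal rescaling. -/
theorem ricci_conformal (hg : RegularOn D g) (hD : IsOpen D) (hw : ContDiffOn ℝ ∞ w D)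
    {p : ι → ℝ} (hp : p ∈ D) (i j : ι) :
    ricci (conformal w g) p i j = ricci g p i j
      - ((Fintype.card ι : ℝ) - 2) * (hess g w p i j - pderiv i w p * pderiv j w p)
      - g p i j * (box g w p + ((Fintype.card ι : ℝ) - 2) * gradInner g w w p) := by
  have dΓ : ∀ k i j, DifferentiableAt ℝ (christoffel g k i j) p :=
    fun k i j => (hg.smooth_christoffel hD k i j).diffAt hD hp
  have dw : ∀ i, DifferentiableAt ℝ (pderiv i w) p :=
    fun i => (contDiffOn_pderiv hD hw i).diffAt hD hp
  have dW : ∀ k, DifferentiableAt ℝ (grad g w k) p :=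
    fun k => (hg.smooth_grad hD hw k).diffAt hD hp
  have dg := fun i j => hg.diff hD hp i j
  have hΓ : ∀ m k i j, pderiv m (christoffel (conformal w g) k i j) p
      = pderiv m (christoffel g k i j) p
      + ((if k = i then 1 else 0) * pderiv m (pderiv j w) p
        + (if k = j then 1 else 0) * pderiv m (pderiv i w) p
        - (g p i j * pderiv m (grad g w k) p
          + pderiv m (fun q => g q i j) p * grad g w k p)) := by
    intro m k i j
    rw [pderiv_congr hD hp (fun q hq => hg.christoffel_conformal hD hw hq k i j),
      pderiv_add (dΓ k i j) ((((dw j).const_mul _).fun_add ((dw i).const_mul _)).fun_sub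
        ((dg i j).fun_mul (dW k))),
      pderiv_sub (((dw j).const_mul _).fun_add ((dw i).const_mul _)) ((dg i j).fun_mul (dW k)),
      pderiv_add ((dw j).const_mul _) ((dw i).const_mul _), pderiv_const_mul, pderiv_const_mul,
      pderiv_mul (dg i j) (dW k)]
  have hdiv : ∑ k, (pderiv k (christoffel (conformal w g) k i j) p
        - pderiv j (christoffel (conformal w g) k i k) p)
      = ∑ k, (pderiv k (christoffel g k i j) p - pderiv j (christoffel g k i k) p)
        + (2 - (Fintype.card ι : ℝ)) * pderiv i (pderiv j w) p
        - g p i j * ∑ k, pderiv k (grad g w k) p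
        - (∑ k, g p i k * ∑ l, christoffel g k j l p * grad g w l p
          + ∑ k, g p j k * ∑ l, christoffel g k i l p * grad g w l p) := by
    -- By metric compatibility the derivative of the factor g_{ij} yields exactly the terms that
    -- `connection_quadratic` produces with the opposite sign.
    have e1 : ∑ k, pderiv k (fun q => g q i j) p * grad g w k p
        = ∑ k, g p i k * ∑ l, christoffel g k j l p * grad g w l p
          + ∑ k, g p j k * ∑ l, christoffel g k i l p * grad g w l p := by
      simp only [hg.pderiv_metric hD hp, add_mul, Finset.sum_add_distrib, Finset.sum_mul,
        Finset.mul_sum]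
      congr 1 <;>
      · rw [Finset.sum_comm]
        refine Finset.sum_congr rfl fun k _ => Finset.sum_congr rfl fun l _ => ?_
        rw [hg.christoffel_symm hD hp k l]; ring
    -- The derivative of g_{ik} Wᵏ recombines into a second partial derivative of w.
    have e2 := hg.pderiv_pderiv hD hw hp j i
    simp only [hΓ, Finset.sum_sub_distrib, Finset.sum_add_distrib, ite_mul, one_mul, zero_mul,
      Finset.sum_ite_eq', Finset.mem_univ, if_true, ← Finset.mul_sum, Finset.sum_const,
      Finset.card_univ, nsmul_eq_mul, e1]
    rw [pderiv_comm hD hw hp j i] at *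
    linarith
  have hquad := connection_quadratic (fun k i j => christoffel g k i j p) (fun i => pderiv i w p)
    (fun k => grad g w k p) (g p) (fun k i j => hg.christoffel_symm hD hp k i j)
    (fun i j => hg.symm p hp i j) (fun a => hg.sum_mul_grad hp w a)
    (fun k i j => christoffel (conformal w g) k i j p - christoffel g k i j p)
    (fun k i j => by rw [hg.christoffel_conformal hD hw hp]; ring) i j
  simp only [add_sub_cancel] at hquad
  rw [ricci, hdiv, hquad, ricci, hess, hg.box_eq_div_grad hD hw hp, gradInner]
  ring

end RegularOn
end Conformal

/-! ### Product metrics ε dy² + q and separated functions. -/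

section Product

variable {n : ℕ}

theorem hasFDerivAt_tail (p : Fin (n + 1) → ℝ) :
    HasFDerivAt (fun q : Fin (n + 1) → ℝ => (Fin.tail q : Fin n → ℝ))
      (ContinuousLinearMap.pi fun i : Fin n => ContinuousLinearMap.proj (R := ℝ) i.succ) p :=
  (ContinuousLinearMap.pi fun i : Fin n =>
    ContinuousLinearMap.proj (R := ℝ) (φ := fun _ : Fin (n + 1) => ℝ) i.succ).hasFDerivAt

theorem contDiff_tail : ContDiff ℝ ∞ (fun q : Fin (n + 1) → ℝ => (Fin.tail q : Fin n → ℝ)) :=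
  (ContinuousLinearMap.pi fun i : Fin n =>
    ContinuousLinearMap.proj (R := ℝ) (φ := fun _ : Fin (n + 1) => ℝ) i.succ).contDiff

theorem differentiableAt_comp_tail_iff {f : (Fin n → ℝ) → ℝ} {p : Fin (n + 1) → ℝ} :
    DifferentiableAt ℝ (fun q => f (Fin.tail q)) p ↔ DifferentiableAt ℝ f (Fin.tail p) := by
  constructor
  · intro h
    have hc : DifferentiableAt ℝ (fun x : Fin n → ℝ => (Fin.cons (p 0) x : Fin (n + 1) → ℝ))
        (Fin.tail p) := by
      rw [differentiableAt_pi]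
      intro i
      refine Fin.cases ?_ (fun j => ?_) i
      · simp
      · simpa using differentiableAt_apply j (Fin.tail p)
    have h' : DifferentiableAt ℝ (fun q => f (Fin.tail q))
        (Fin.cons (p 0) (Fin.tail p) : Fin (n + 1) → ℝ) := by
      rwa [Fin.cons_self_tail]
    simpa [Function.comp_def] using DifferentiableAt.comp (Fin.tail p) h' hc
  · intro h
    exact DifferentiableAt.comp p h (hasFDerivAt_tail p).differentiableAt

/-- No differentiability is assumed: f and its composition with `Fin.tail` are differentiable
together, so otherwise both derivatives have the default value zero. -/
theorem fderiv_comp_tail (f : (Fin n → ℝ) → ℝ) (p v : Fin (n + 1) → ℝ) :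
    fderiv ℝ (fun q => f (Fin.tail q)) p v = fderiv ℝ f (Fin.tail p) (Fin.tail v) := by
  by_cases h : DifferentiableAt ℝ f (Fin.tail p)
  · have := (h.hasFDerivAt.comp p (hasFDerivAt_tail p)).fderiv
    simp only [Function.comp_def] at this
    rw [this]; rfl
  · rw [fderiv_zero_of_not_differentiableAt h,
      fderiv_zero_of_not_differentiableAt (mt differentiableAt_comp_tail_iff.1 h)]
    rfl

theorem pderiv_zero_comp_tail (f : (Fin n → ℝ) → ℝ) (p : Fin (n + 1) → ℝ) :
    pderiv 0 (fun q => f (Fin.tail q)) p = 0 := by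
  have : Fin.tail (Pi.single 0 1 : Fin (n + 1) → ℝ) = 0 := by
    ext i; simp [Fin.tail]
  rw [pderiv, fderiv_comp_tail, this, map_zero]

theorem pderiv_succ_comp_tail (f : (Fin n → ℝ) → ℝ) (p : Fin (n + 1) → ℝ) (i : Fin n) :
    pderiv i.succ (fun q => f (Fin.tail q)) p = pderiv i f (Fin.tail p) := by
  have : Fin.tail (Pi.single i.succ 1 : Fin (n + 1) → ℝ) = Pi.single i 1 := by
    ext j; simp [Fin.tail, Pi.single_apply]
  rw [pderiv, fderiv_comp_tail, this, pderiv]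

theorem hasFDerivAt_comp_coord {ι : Type*} [Fintype ι] (a : ι) {f : ℝ → ℝ} {p : ι → ℝ}
    (hf : DifferentiableAt ℝ f (p a)) :
    HasFDerivAt (fun q => f (q a)) (deriv f (p a) • ContinuousLinearMap.proj (R := ℝ) a) p :=
  hf.hasDerivAt.comp_hasFDerivAt p
    (ContinuousLinearMap.proj (R := ℝ) (φ := fun _ : ι => ℝ) a).hasFDerivAt

theorem pderiv_comp_coord {ι : Type*} [Fintype ι] [DecidableEq ι] (a : ι) {f : ℝ → ℝ} {p : ι → ℝ}
    (hf : DifferentiableAt ℝ f (p a)) (i : ι) :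
    pderiv i (fun q => f (q a)) p = if i = a then deriv f (p a) else 0 := by
  rw [pderiv, (hasFDerivAt_comp_coord a hf).fderiv]
  simp [Pi.single_apply, eq_comm]

@[simp] theorem blockForm_zero_zero (a : ℝ) (B : Matrix (Fin n) (Fin n) ℝ) :
    blockForm a B 0 0 = a := rfl
@[simp] theorem blockForm_zero_succ (a : ℝ) (B : Matrix (Fin n) (Fin n) ℝ) (j : Fin n) :
    blockForm a B 0 j.succ = 0 := rfl
@[simp] theorem blockForm_succ_zero (a : ℝ) (B : Matrix (Fin n) (Fin n) ℝ) (j : Fin n) :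
    blockForm a B j.succ 0 = 0 := rfl
@[simp] theorem blockForm_succ_succ (a : ℝ) (B : Matrix (Fin n) (Fin n) ℝ) (i j : Fin n) :
    blockForm a B i.succ j.succ = B i j := rfl

theorem blockForm_mul (a b : ℝ) (A B : Matrix (Fin n) (Fin n) ℝ) :
    blockForm a A * blockForm b B = blockForm (a * b) (A * B) := by
  ext i j
  refine Fin.cases ?_ (fun i => ?_) i <;> refine Fin.cases ?_ (fun j => ?_) j <;>
    simp [Matrix.mul_apply, Fin.sum_univ_succ]

theorem blockForm_one : blockForm 1 (1 : Matrix (Fin n) (Fin n) ℝ) = 1 := by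
  ext i j
  refine Fin.cases ?_ (fun i => ?_) i <;> refine Fin.cases ?_ (fun j => ?_) j <;>
    simp [Matrix.one_apply, Fin.succ_ne_zero, eq_comm]

theorem blockForm_inv {a : ℝ} (ha : a ≠ 0) {B : Matrix (Fin n) (Fin n) ℝ} (hB : IsUnit B.det) :
    (blockForm a B)⁻¹ = blockForm a⁻¹ B⁻¹ := by
  apply Matrix.inv_eq_left_inv
  rw [blockForm_mul, inv_mul_cancel₀ ha, Matrix.nonsing_inv_mul _ hB, blockForm_one]

theorem smul_blockForm (c a : ℝ) (B : Matrix (Fin n) (Fin n) ℝ) :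
    c • blockForm a B = blockForm (c * a) (c • B) := by
  ext i j
  refine Fin.cases ?_ (fun i => ?_) i <;> refine Fin.cases ?_ (fun j => ?_) j <;> simp

theorem isOpen_domain {I : Set ℝ} {Ω : Set (Fin n → ℝ)} (hI : IsOpen I) (hΩ : IsOpen Ω) :
    IsOpen (domain I Ω) :=
  (hI.preimage (continuous_apply 0)).inter (hΩ.preimage contDiff_tail.continuous)

/-- The product metric `ε dy² + q_{ij}(x) dxⁱ dxʲ`. -/
def productMetric (ε : ℝ) (q : (Fin n → ℝ) → Matrix (Fin n) (Fin n) ℝ) (p : Fin (n + 1) → ℝ) :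
    Matrix (Fin (n + 1)) (Fin (n + 1)) ℝ :=
  blockForm ε (q (Fin.tail p))

/-- The separated function `b V(x) + a μ(y)`. -/
def sepField (b : ℝ) (V : (Fin n → ℝ) → ℝ) (a : ℝ) (μ : ℝ → ℝ) (p : Fin (n + 1) → ℝ) : ℝ :=
  b * V (Fin.tail p) + a * μ (p 0)

variable {I : Set ℝ} {Ω : Set (Fin n → ℝ)} {q : (Fin n → ℝ) → Matrix (Fin n) (Fin n) ℝ}
  {ε : ℝ} {V : (Fin n → ℝ) → ℝ} {μ : ℝ → ℝ}

theorem contDiffOn_comp_tail (hV : ContDiffOn ℝ ∞ V Ω) :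
    ContDiffOn ℝ ∞ (fun p => V (Fin.tail p)) (domain I Ω) :=
  hV.comp contDiff_tail.contDiffOn fun _ hp => hp.2

theorem contDiffOn_comp_head (hμ : ContDiffOn ℝ ∞ μ I) :
    ContDiffOn ℝ ∞ (fun p : Fin (n + 1) → ℝ => μ (p 0)) (domain I Ω) :=
  hμ.comp (contDiff_apply ℝ ℝ (0 : Fin (n + 1))).contDiffOn fun _ hp => hp.1

theorem contDiffOn_sepField (hV : ContDiffOn ℝ ∞ V Ω) (hμ : ContDiffOn ℝ ∞ μ I) (a b : ℝ) :
    ContDiffOn ℝ ∞ (sepField b V a μ) (domain I Ω) :=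
  (contDiffOn_const.mul (contDiffOn_comp_tail hV)).add
    (contDiffOn_const.mul (contDiffOn_comp_head hμ))

theorem RegularOn.product (hq : RegularOn Ω q) (hε : ε ≠ 0) :
    RegularOn (domain I Ω) (productMetric ε q) where
  smooth i j := by
    refine Fin.cases ?_ (fun i => ?_) i <;> refine Fin.cases ?_ (fun j => ?_) j
    · exact contDiffOn_const
    · exact contDiffOn_const
    · exact contDiffOn_const
    · exact contDiffOn_comp_tail (hq.smooth i j)
  symm p hp i j := by
    refine Fin.cases ?_ (fun i => ?_) i <;> refine Fin.cases ?_ (fun j => ?_) j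
    · rfl
    · rfl
    · rfl
    · exact hq.symm _ hp.2 i j
  nondeg p hp := by
    refine Matrix.isUnit_det_of_left_inverse (B := blockForm ε⁻¹ (q (Fin.tail p))⁻¹) ?_
    rw [productMetric, blockForm_mul, inv_mul_cancel₀ hε,
      Matrix.nonsing_inv_mul _ (hq.nondeg _ hp.2), blockForm_one]

section Components

variable (hq : RegularOn Ω q) (hε : ε ≠ 0) {p : Fin (n + 1) → ℝ} (hp : p ∈ domain I Ω)
include hq hε hp

theorem productMetric_inv : (productMetric ε q p)⁻¹ = blockForm ε⁻¹ (q (Fin.tail p))⁻¹ :=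
  blockForm_inv hε (hq.nondeg _ hp.2)

theorem christoffel_product_succ (k i j : Fin n) :
    christoffel (productMetric ε q) k.succ i.succ j.succ p = christoffel q k i j (Fin.tail p) := by
  rw [christoffel, christoffel, productMetric_inv hq hε hp, Fin.sum_univ_succ]
  simp only [blockForm_succ_zero, zero_mul, zero_add, blockForm_succ_succ, productMetric]
  congr 1
  refine Finset.sum_congr rfl fun l _ => ?_
  rw [pderiv_succ_comp_tail (fun x => q x j l), pderiv_succ_comp_tail (fun x => q x i l),
    pderiv_succ_comp_tail (fun x => q x i j)]

theorem christoffel_product_zero_upper (i j : Fin (n + 1)) :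
    christoffel (productMetric ε q) 0 i j p = 0 := by
  rw [christoffel, productMetric_inv hq hε hp, Fin.sum_univ_succ]
  refine Fin.cases ?_ (fun i => ?_) i <;> refine Fin.cases ?_ (fun j => ?_) j <;>
    simp [productMetric, pderiv_const, fun a b => pderiv_zero_comp_tail (fun x => q x a b) p]

theorem christoffel_product_zero_left (k j : Fin (n + 1)) :
    christoffel (productMetric ε q) k 0 j p = 0 := by
  rw [christoffel, productMetric_inv hq hε hp, Fin.sum_univ_succ]
  refine Fin.cases ?_ (fun k => ?_) k <;> refine Fin.cases ?_ (fun j => ?_) j <;>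
    simp [productMetric, pderiv_const, fun a b => pderiv_zero_comp_tail (fun x => q x a b) p]

theorem christoffel_product_zero_right (k i : Fin (n + 1)) :
    christoffel (productMetric ε q) k i 0 p = 0 := by
  rw [christoffel, productMetric_inv hq hε hp, Fin.sum_univ_succ]
  refine Fin.cases ?_ (fun k => ?_) k <;> refine Fin.cases ?_ (fun i => ?_) i <;>
    simp [productMetric, pderiv_const, fun a b => pderiv_zero_comp_tail (fun x => q x a b) p]

end Components

section Curvature

variable (hI : IsOpen I) (hΩ : IsOpen Ω) (hq : RegularOn Ω q) (hε : ε ≠ 0)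
  {p : Fin (n + 1) → ℝ} (hp : p ∈ domain I Ω)
include hI hΩ hq hε hp

theorem pderiv_christoffel_product_succ (m k i j : Fin n) :
    pderiv m.succ (christoffel (productMetric ε q) k.succ i.succ j.succ) p
      = pderiv m (christoffel q k i j) (Fin.tail p) := by
  rw [pderiv_congr (isOpen_domain hI hΩ) hp
    (fun r hr => christoffel_product_succ hq hε hr k i j), pderiv_succ_comp_tail]

/-- The symbols carrying an index 0 vanish on the whole open domain, and the others are functions of
x alone. -/
theorem pderiv_christoffel_product_zero (k i j : Fin (n + 1)) :
    pderiv 0 (christoffel (productMetric ε q) k i j) p = 0 := by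
  refine Fin.cases ?_ (fun k => ?_) k
  · rw [pderiv_congr (isOpen_domain hI hΩ) hp
      (fun r hr => christoffel_product_zero_upper hq hε hr i j), pderiv_const]
  refine Fin.cases ?_ (fun i => ?_) i
  · rw [pderiv_congr (isOpen_domain hI hΩ) hp
      (fun r hr => christoffel_product_zero_left hq hε hr k.succ j), pderiv_const]
  refine Fin.cases ?_ (fun j => ?_) j
  · rw [pderiv_congr (isOpen_domain hI hΩ) hp
      (fun r hr => christoffel_product_zero_right hq hε hr k.succ i.succ), pderiv_const]
  rw [pderiv_congr (isOpen_domain hI hΩ) hp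
    (fun r hr => christoffel_product_succ hq hε hr k i j), pderiv_zero_comp_tail]

theorem pderiv_christoffel_product_zero_upper (m i j : Fin (n + 1)) :
    pderiv m (christoffel (productMetric ε q) 0 i j) p = 0 := by
  rw [pderiv_congr (isOpen_domain hI hΩ) hp
    (fun r hr => christoffel_product_zero_upper hq hε hr i j), pderiv_const]

theorem pderiv_christoffel_product_zero_left (m k j : Fin (n + 1)) :
    pderiv m (christoffel (productMetric ε q) k 0 j) p = 0 := by
  rw [pderiv_congr (isOpen_domain hI hΩ) hp
    (fun r hr => christoffel_product_zero_left hq hε hr k j), pderiv_const]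

theorem pderiv_christoffel_product_zero_right (m k i : Fin (n + 1)) :
    pderiv m (christoffel (productMetric ε q) k i 0) p = 0 := by
  rw [pderiv_congr (isOpen_domain hI hΩ) hp
    (fun r hr => christoffel_product_zero_right hq hε hr k i), pderiv_const]

theorem ricci_product_zero_left (j : Fin (n + 1)) : ricci (productMetric ε q) p 0 j = 0 := by
  simp [ricci, pderiv_christoffel_product_zero_left hI hΩ hq hε hp,
    christoffel_product_zero_left hq hε hp]

theorem ricci_product_zero_right (i : Fin (n + 1)) : ricci (productMetric ε q) p i 0 = 0 := by
  simp [ricci, pderiv_christoffel_product_zero_right hI hΩ hq hε hp,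
    pderiv_christoffel_product_zero hI hΩ hq hε hp,
    christoffel_product_zero_right hq hε hp, christoffel_product_zero_left hq hε hp]

theorem ricci_product_succ (i j : Fin n) :
    ricci (productMetric ε q) p i.succ j.succ = ricci q (Fin.tail p) i j := by
  simp [ricci, Fin.sum_univ_succ, pderiv_christoffel_product_zero_upper hI hΩ hq hε hp,
    pderiv_christoffel_product_succ hI hΩ hq hε hp,
    christoffel_product_zero_upper hq hε hp,
    christoffel_product_zero_right hq hε hp, christoffel_product_succ hq hε hp]

end Curvature

section Fields

variable (hI : IsOpen I) (hΩ : IsOpen Ω) (hV : ContDiffOn ℝ ∞ V Ω) (hμ : ContDiffOn ℝ ∞ μ I)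
  (a b : ℝ) {p : Fin (n + 1) → ℝ} (hp : p ∈ domain I Ω)
include hI hΩ hV hμ hp

theorem pderiv_zero_sepField : pderiv 0 (sepField b V a μ) p = a * deriv μ (p 0) := by
  have h1 := (contDiffOn_comp_tail (I := I) hV).diffAt (isOpen_domain hI hΩ) hp
  have h2 := (contDiffOn_comp_head (Ω := Ω) hμ).diffAt (isOpen_domain hI hΩ) hp
  have h3 : DifferentiableAt ℝ μ (p 0) :=
    (hμ.contDiffAt (hI.mem_nhds hp.1)).differentiableAt (by simp)
  have := pderiv_add (h1.const_mul b) (h2.const_mul a) 0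
  rw [pderiv_const_mul, pderiv_const_mul, pderiv_zero_comp_tail, pderiv_comp_coord _ h3] at this
  exact this.trans (by simp)

theorem pderiv_succ_sepField (i : Fin n) :
    pderiv i.succ (sepField b V a μ) p = b * pderiv i V (Fin.tail p) := by
  have h1 := (contDiffOn_comp_tail (I := I) hV).diffAt (isOpen_domain hI hΩ) hp
  have h2 := (contDiffOn_comp_head (Ω := Ω) hμ).diffAt (isOpen_domain hI hΩ) hp
  have h3 : DifferentiableAt ℝ μ (p 0) :=
    (hμ.contDiffAt (hI.mem_nhds hp.1)).differentiableAt (by simp)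
  have := pderiv_add (h1.const_mul b) (h2.const_mul a) i.succ
  rw [pderiv_const_mul, pderiv_const_mul, pderiv_succ_comp_tail, pderiv_comp_coord _ h3,
    if_neg (Fin.succ_ne_zero i)] at this
  exact this.trans (by simp)

variable (hq : RegularOn Ω q) (hε : ε ≠ 0)
include hq hε

theorem hess_product_zero_zero :
    hess (productMetric ε q) (sepField b V a μ) p 0 0 = a * deriv (deriv μ) (p 0) := by
  have hμ' : ContDiffOn ℝ ∞ (deriv μ) I := hμ.deriv_of_isOpen hI (m := ∞) (by simp)
  have h3 : DifferentiableAt ℝ (deriv μ) (p 0) :=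
    (hμ'.contDiffAt (hI.mem_nhds hp.1)).differentiableAt (by simp)
  rw [hess, pderiv_congr (isOpen_domain hI hΩ) hp
    (fun r hr => pderiv_zero_sepField hI hΩ hV hμ a b hr), pderiv_const_mul,
    pderiv_comp_coord _ h3]
  simp [christoffel_product_zero_left hq hε hp]

theorem hess_product_zero_succ (j : Fin n) :
    hess (productMetric ε q) (sepField b V a μ) p 0 j.succ = 0 := by
  rw [hess, pderiv_congr (isOpen_domain hI hΩ) hp
    (fun r hr => pderiv_succ_sepField hI hΩ hV hμ a b hr j), pderiv_const_mul,
    pderiv_zero_comp_tail]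
  simp [christoffel_product_zero_left hq hε hp]

theorem hess_product_succ_zero (j : Fin n) :
    hess (productMetric ε q) (sepField b V a μ) p j.succ 0 = 0 := by
  have hμ' : ContDiffOn ℝ ∞ (deriv μ) I := hμ.deriv_of_isOpen hI (m := ∞) (by simp)
  have h3 : DifferentiableAt ℝ (deriv μ) (p 0) :=
    (hμ'.contDiffAt (hI.mem_nhds hp.1)).differentiableAt (by simp)
  rw [hess, pderiv_congr (isOpen_domain hI hΩ) hp
    (fun r hr => pderiv_zero_sepField hI hΩ hV hμ a b hr), pderiv_const_mul,
    pderiv_comp_coord _ h3]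
  simp [christoffel_product_zero_right hq hε hp]

theorem hess_product_succ_succ (i j : Fin n) :
    hess (productMetric ε q) (sepField b V a μ) p i.succ j.succ
      = b * hess q V (Fin.tail p) i j := by
  rw [hess, pderiv_congr (isOpen_domain hI hΩ) hp
    (fun r hr => pderiv_succ_sepField hI hΩ hV hμ a b hr j), pderiv_const_mul,
    pderiv_succ_comp_tail, Fin.sum_univ_succ, hess, mul_sub, Finset.mul_sum]
  simp only [christoffel_product_zero_upper hq hε hp, christoffel_product_succ hq hε hp,
    pderiv_succ_sepField hI hΩ hV hμ a b hp, zero_mul, zero_add]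
  congr 1
  exact Finset.sum_congr rfl fun k _ => by ring

theorem box_product :
    box (productMetric ε q) (sepField b V a μ) p
      = ε⁻¹ * (a * deriv (deriv μ) (p 0)) + b * box q V (Fin.tail p) := by
  rw [box_eq_sum_hess, box_eq_sum_hess]
  simp only [Fin.sum_univ_succ, productMetric_inv hq hε hp, blockForm_zero_zero,
    blockForm_zero_succ, blockForm_succ_zero, blockForm_succ_succ, zero_mul,
    Finset.sum_const_zero, add_zero, zero_add, hess_product_zero_zero hI hΩ hV hμ a b hp hq hε,
    hess_product_succ_succ hI hΩ hV hμ a b hp hq hε, Finset.mul_sum]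
  congr 1
  exact Finset.sum_congr rfl fun i _ => Finset.sum_congr rfl fun j _ => by ring

theorem gradInner_product (a' b' : ℝ) :
    gradInner (productMetric ε q) (sepField b V a μ) (sepField b' V a' μ) p
      = ε⁻¹ * (a * a' * deriv μ (p 0) ^ 2) + b * b' * gradInner q V V (Fin.tail p) := by
  simp only [gradInner, grad, Fin.sum_univ_succ, productMetric_inv hq hε hp, blockForm_zero_zero,
    blockForm_zero_succ, blockForm_succ_zero, blockForm_succ_succ, zero_mul,
    Finset.sum_const_zero, add_zero, zero_add, pderiv_zero_sepField hI hΩ hV hμ _ _ hp,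
    pderiv_succ_sepField hI hΩ hV hμ _ _ hp, Finset.mul_sum]
  congr 1
  · ring
  · exact Finset.sum_congr rfl fun i _ => Finset.sum_congr rfl fun j _ => by ring

end Fields
end Product

/-! ### Constant multiples of functions. -/

section Scaling
variable {ι : Type*} [Fintype ι] [DecidableEq ι] (g : (ι → ℝ) → Matrix ι ι ℝ) (c d : ℝ)
  (φ ψ : (ι → ℝ) → ℝ) (p : ι → ℝ)

theorem hess_const_mul (i j : ι) : hess g (fun x => c * φ x) p i j = c * hess g φ p i j := by
  have : pderiv j (fun x => c * φ x) = fun x => c * pderiv j φ x := by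
    ext x; exact pderiv_const_mul _ _ _ _
  rw [hess, hess, this, mul_sub, pderiv_const_mul, Finset.mul_sum]
  congr 1
  exact Finset.sum_congr rfl fun k _ => by rw [pderiv_const_mul]; ring

theorem box_const_mul : box g (fun x => c * φ x) p = c * box g φ p := by
  simp only [box_eq_sum_hess, hess_const_mul, Finset.mul_sum]
  exact Finset.sum_congr rfl fun i _ => Finset.sum_congr rfl fun j _ => by ring

theorem gradInner_const_mul :
    gradInner g (fun x => c * φ x) (fun x => d * ψ x) p = c * d * gradInner g φ ψ p := by
  simp only [gradInner, grad, pderiv_const_mul, Finset.mul_sum]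
  exact Finset.sum_congr rfl fun i _ => Finset.sum_congr rfl fun j _ => by ring

theorem gradInner_const_mul_right :
    gradInner g φ (fun x => d * ψ x) p = d * gradInner g φ ψ p := by
  simp only [gradInner, grad, pderiv_const_mul, Finset.mul_sum]
  exact Finset.sum_congr rfl fun i _ => Finset.sum_congr rfl fun j _ => by ring

end Scaling

/-! ### Curvature of the inflated metric. -/

section Template

variable {n : ℕ}

/-- The metric `e^{2(αV + μ)} (ε dy² + e^{2τV} q)`. -/
def inflatedMetric (ε α τ : ℝ) (μ : ℝ → ℝ) (V : (Fin n → ℝ) → ℝ)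
    (q : (Fin n → ℝ) → Matrix (Fin n) (Fin n) ℝ) :
    (Fin (n + 1) → ℝ) → Matrix (Fin (n + 1)) (Fin (n + 1)) ℝ :=
  conformal (sepField α V 1 μ) (productMetric ε (conformal (fun x => τ * V x) q))

/-- On h the exponents agree because -2α - 2δ = 2α + 2τ - 4 for τ = 2 - 2α - δ. -/
theorem Template.metric_eq_inflatedMetric (T : Template) (ε : ℝ) (V : (Fin n → ℝ) → ℝ)
    (h : (Fin n → ℝ) → Matrix (Fin n) (Fin n) ℝ) :
    T.metric ε V h = inflatedMetric ε T.α (2 - 2 * T.α - T.δ) T.μ V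
      (conformal (fun x => -2 * V x) h) := by
  funext p
  simp only [Template.metric, orthMetric, inflatedMetric, conformal, productMetric, sepField,
    smul_blockForm, smul_smul, ← Real.exp_add]
  congr 1
  · rw [mul_left_comm, ← Real.exp_add, mul_comm]; ring_nf
  · ring_nf

/-- The trivial template, which returns the seed. -/
def Template.trivial : Template := ⟨1, 0, 0, 0, fun _ => 0⟩

theorem Template.trivial_metric (ε : ℝ) (V : (Fin n → ℝ) → ℝ)
    (h : (Fin n → ℝ) → Matrix (Fin n) (Fin n) ℝ) :
    Template.trivial.metric ε V h = orthMetric ε V h := by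
  funext p
  simp [Template.metric, Template.trivial, orthMetric]

variable {I : Set ℝ} {Ω : Set (Fin n → ℝ)} {q : (Fin n → ℝ) → Matrix (Fin n) (Fin n) ℝ}
  {ε : ℝ} {V : (Fin n → ℝ) → ℝ} {μ : ℝ → ℝ}

section Ricci

variable (hI : IsOpen I) (hΩ : IsOpen Ω) (hV : ContDiffOn ℝ ∞ V Ω) (hμ : ContDiffOn ℝ ∞ μ I)
  (hq : RegularOn Ω q) (hε : ε * ε = 1) (α τ : ℝ) {p : Fin (n + 1) → ℝ} (hp : p ∈ domain I Ω)
include hI hΩ hV hμ hq hε hp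

/-- Factors n - 2 come from rescaling q in dimension n, factors n - 1 from rescaling the product in
dimension n + 1. The terms in μ'² cancel: (n-1)μ'² from dμ ⊗ dμ against the same term in the trace
part. -/
theorem ricci_inflatedMetric_zero_zero :
    ricci (inflatedMetric ε α τ μ V q) p 0 0 = -n * deriv (deriv μ) (p 0)
      - ε * α * (Real.exp (2 * (τ * V (Fin.tail p))))⁻¹ * (box q V (Fin.tail p)
        + ((n - 2) * τ + (n - 1) * α) * gradInner q V V (Fin.tail p)) := by
  have hε0 : ε ≠ 0 := left_ne_zero_of_mul_eq_one hε
  have hεi : ε⁻¹ = ε := inv_eq_of_mul_eq_one_left hε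
  have hτ : ContDiffOn ℝ ∞ (fun x => τ * V x) Ω := contDiffOn_const.mul hV
  have hqτ := hq.conformal_metric hτ
  have hD := isOpen_domain hI hΩ
  rw [inflatedMetric, (hqτ.product hε0).ricci_conformal hD (contDiffOn_sepField hV hμ _ _) hp,
    ricci_product_zero_left hI hΩ hqτ hε0 hp, hess_product_zero_zero hI hΩ hV hμ _ _ hp hqτ hε0,
    box_product hI hΩ hV hμ _ _ hp hqτ hε0, gradInner_product hI hΩ hV hμ _ _ hp hqτ hε0,
    pderiv_zero_sepField hI hΩ hV hμ _ _ hp, hq.box_conformal hΩ hτ hp.2,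
    hq.gradInner_conformal hp.2, gradInner_const_mul_right, hεi]
  simp only [productMetric, blockForm_zero_zero, Fintype.card_fin]
  push_cast
  linear_combination (-deriv (deriv μ) (p 0) - (n - 1) * deriv μ (p 0) ^ 2) * hε

/-- The product metric has no mixed Ricci or Hessian component here, so only the product of the
differentials of αV and μ remains. -/
theorem ricci_inflatedMetric_zero_succ (i : Fin n) :
    ricci (inflatedMetric ε α τ μ V q) p 0 i.succ
      = (n - 1) * α * (deriv μ (p 0) * pderiv i V (Fin.tail p)) := by
  have hε0 : ε ≠ 0 := left_ne_zero_of_mul_eq_one hε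
  have hτ : ContDiffOn ℝ ∞ (fun x => τ * V x) Ω := contDiffOn_const.mul hV
  have hqτ := hq.conformal_metric hτ
  have hD := isOpen_domain hI hΩ
  rw [inflatedMetric, (hqτ.product hε0).ricci_conformal hD (contDiffOn_sepField hV hμ _ _) hp,
    ricci_product_zero_left hI hΩ hqτ hε0 hp, hess_product_zero_succ hI hΩ hV hμ _ _ hp hqτ hε0,
    pderiv_zero_sepField hI hΩ hV hμ _ _ hp, pderiv_succ_sepField hI hΩ hV hμ _ _ hp]
  simp only [productMetric, blockForm_zero_succ, Fintype.card_fin]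
  push_cast
  ring

theorem ricci_inflatedMetric_succ_zero (i : Fin n) :
    ricci (inflatedMetric ε α τ μ V q) p i.succ 0
      = (n - 1) * α * (deriv μ (p 0) * pderiv i V (Fin.tail p)) := by
  have hε0 : ε ≠ 0 := left_ne_zero_of_mul_eq_one hε
  have hτ : ContDiffOn ℝ ∞ (fun x => τ * V x) Ω := contDiffOn_const.mul hV
  have hqτ := hq.conformal_metric hτ
  have hD := isOpen_domain hI hΩ
  rw [inflatedMetric, (hqτ.product hε0).ricci_conformal hD (contDiffOn_sepField hV hμ _ _) hp,
    ricci_product_zero_right hI hΩ hqτ hε0 hp, hess_product_succ_zero hI hΩ hV hμ _ _ hp hqτ hε0,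
    pderiv_zero_sepField hI hΩ hV hμ _ _ hp, pderiv_succ_sepField hI hΩ hV hμ _ _ hp]
  simp only [productMetric, blockForm_succ_zero, Fintype.card_fin]
  push_cast
  ring

theorem ricci_inflatedMetric_succ_succ (i j : Fin n) :
    ricci (inflatedMetric ε α τ μ V q) p i.succ j.succ
      = ricci q (Fin.tail p) i j
        - ((n - 2) * τ + (n - 1) * α) * hess q V (Fin.tail p) i j
        + ((n - 2) * τ ^ 2 + (n - 1) * (α ^ 2 + 2 * α * τ))
          * (pderiv i V (Fin.tail p) * pderiv j V (Fin.tail p))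
        - q (Fin.tail p) i j * ((τ + α) * (box q V (Fin.tail p)
            + ((n - 2) * τ + (n - 1) * α) * gradInner q V V (Fin.tail p))
          + Real.exp (2 * (τ * V (Fin.tail p))) * ε
            * (deriv (deriv μ) (p 0) + (n - 1) * deriv μ (p 0) ^ 2)) := by
  have hε0 : ε ≠ 0 := left_ne_zero_of_mul_eq_one hε
  have hεi : ε⁻¹ = ε := inv_eq_of_mul_eq_one_left hε
  have hτ : ContDiffOn ℝ ∞ (fun x => τ * V x) Ω := contDiffOn_const.mul hV
  have hqτ := hq.conformal_metric hτ
  have hD := isOpen_domain hI hΩ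
  rw [inflatedMetric, (hqτ.product hε0).ricci_conformal hD (contDiffOn_sepField hV hμ _ _) hp,
    ricci_product_succ hI hΩ hqτ hε0 hp, hess_product_succ_succ hI hΩ hV hμ _ _ hp hqτ hε0,
    box_product hI hΩ hV hμ _ _ hp hqτ hε0, gradInner_product hI hΩ hV hμ _ _ hp hqτ hε0,
    pderiv_succ_sepField hI hΩ hV hμ _ _ hp, pderiv_succ_sepField hI hΩ hV hμ _ _ hp,
    hq.box_conformal hΩ hτ hp.2, hq.gradInner_conformal hp.2, hq.ricci_conformal hΩ hτ hp.2,
    hq.hess_conformal hΩ hτ hp.2, hess_const_mul, box_const_mul, gradInner_const_mul,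
    gradInner_const_mul_right, pderiv_const_mul, pderiv_const_mul, hεi]
  simp only [productMetric, blockForm_succ_succ, Fintype.card_fin, conformal, Matrix.smul_apply,
    smul_eq_mul]
  push_cast
  field_simp
  ring

theorem box_inflatedMetric (σ ρ : ℝ) :
    box (inflatedMetric ε α τ μ V q) (sepField σ V ρ μ) p
      = (Real.exp (2 * sepField α V 1 μ p))⁻¹ *
        (ρ * ε * (deriv (deriv μ) (p 0) + (n - 1) * deriv μ (p 0) ^ 2)
          + σ * (Real.exp (2 * (τ * V (Fin.tail p))))⁻¹ * (box q V (Fin.tail p)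
            + ((n - 2) * τ + (n - 1) * α) * gradInner q V V (Fin.tail p))) := by
  have hε0 : ε ≠ 0 := left_ne_zero_of_mul_eq_one hε
  have hεi : ε⁻¹ = ε := inv_eq_of_mul_eq_one_left hε
  have hτ : ContDiffOn ℝ ∞ (fun x => τ * V x) Ω := contDiffOn_const.mul hV
  have hqτ := hq.conformal_metric hτ
  have hD := isOpen_domain hI hΩ
  rw [inflatedMetric, (hqτ.product hε0).box_conformal hD (contDiffOn_sepField hV hμ _ _) hp,
    box_product hI hΩ hV hμ _ _ hp hqτ hε0, gradInner_product hI hΩ hV hμ _ _ hp hqτ hε0,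
    hq.box_conformal hΩ hτ hp.2, hq.gradInner_conformal hp.2,
    gradInner_const_mul_right, hεi]
  simp only [Fintype.card_fin]
  push_cast
  ring

end Ricci


end Template

/-! ### Linear algebra of Lorentzian forms. -/

section Lorentzian

variable {n : ℕ}

theorem IsLorentzian.isUnit_det {G : Matrix (Fin (n + 1)) (Fin (n + 1)) ℝ} (hG : IsLorentzian G) :
    IsUnit G.det := by
  obtain ⟨P, -, h⟩ := hG
  have h' := congrArg Matrix.det h
  rw [Matrix.det_mul, Matrix.det_mul, Matrix.det_diagonal] at h'
  rw [isUnit_iff_ne_zero]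
  intro h0
  rw [h0, mul_zero, zero_mul] at h'
  exact Finset.prod_ne_zero_iff.2 (fun a _ => by split_ifs <;> norm_num) h'.symm

/-- Congruence to a diagonal matrix by an invertible P already forces symmetry. -/
theorem IsLorentzian.symm {G : Matrix (Fin (n + 1)) (Fin (n + 1)) ℝ} (hG : IsLorentzian G) :
    Gᵀ = G := by
  obtain ⟨P, hP, h⟩ := hG
  have hPt : IsUnit (Pᵀ).det := by rwa [Matrix.det_transpose]
  have h1 := congrArg Matrix.transpose h
  rw [Matrix.diagonal_transpose, ← h] at h1
  simp only [Matrix.transpose_mul, Matrix.transpose_transpose] at h1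
  rw [Matrix.mul_assoc] at h1
  have h2 := congrArg (fun M => (Pᵀ)⁻¹ * M * P⁻¹) h1
  simpa only [← Matrix.mul_assoc, Matrix.nonsing_inv_mul _ hPt, Matrix.one_mul,
    Matrix.mul_nonsing_inv_cancel_right _ _ hP] using h2

theorem IsLorentzian.congruence {G : Matrix (Fin (n + 1)) (Fin (n + 1)) ℝ} (hG : IsLorentzian G)
    {A : Matrix (Fin (n + 1)) (Fin (n + 1)) ℝ} (hA : IsUnit A.det) : IsLorentzian (Aᵀ * G * A) := by
  obtain ⟨P, hP, h⟩ := hG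
  have hAt : IsUnit (Aᵀ).det := by rwa [Matrix.det_transpose]
  refine ⟨A⁻¹ * P, ?_, ?_⟩
  · rw [Matrix.det_mul]
    exact (Matrix.isUnit_nonsing_inv_det _ hA).mul hP
  · rw [← h, Matrix.transpose_mul, Matrix.transpose_nonsing_inv]
    have e : Pᵀ * (Aᵀ)⁻¹ * (Aᵀ * G * A) * (A⁻¹ * P)
        = Pᵀ * ((Aᵀ)⁻¹ * Aᵀ) * G * (A * A⁻¹) * P := by
      simp only [Matrix.mul_assoc]
    rw [e, Matrix.nonsing_inv_mul _ hAt, Matrix.mul_nonsing_inv _ hA, Matrix.mul_one,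
      Matrix.mul_one]

theorem blockForm_transpose (a : ℝ) (B : Matrix (Fin n) (Fin n) ℝ) :
    (blockForm a B)ᵀ = blockForm a Bᵀ := by
  ext i j
  refine Fin.cases ?_ (fun i => ?_) i <;> refine Fin.cases ?_ (fun j => ?_) j <;> simp

theorem isUnit_det_of_blockForm {a : ℝ} {B : Matrix (Fin n) (Fin n) ℝ}
    (h : IsUnit (blockForm a B).det) : IsUnit B.det := by
  refine Matrix.isUnit_det_of_right_inverse
    (B := Matrix.of fun i j : Fin n => (blockForm a B)⁻¹ i.succ j.succ) ?_
  ext i j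
  have := congrFun (congrFun (Matrix.mul_nonsing_inv _ h) i.succ) j.succ
  rw [Matrix.mul_apply, Fin.sum_univ_succ] at this
  simpa [Matrix.mul_apply, Matrix.one_apply] using this

theorem isUnit_det_blockForm {a : ℝ} (ha : a ≠ 0) {B : Matrix (Fin n) (Fin n) ℝ}
    (hB : IsUnit B.det) : IsUnit (blockForm a B).det := by
  refine Matrix.isUnit_det_of_left_inverse (B := blockForm a⁻¹ B⁻¹) ?_
  rw [blockForm_mul, inv_mul_cancel₀ ha, Matrix.nonsing_inv_mul _ hB, blockForm_one]

end Lorentzian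

/-! ### Reduction of the vacuum and Einstein-scalar equations to q. -/

section Seed

variable {n : ℕ} {I : Set ℝ} {Ω : Set (Fin n → ℝ)} {h : (Fin n → ℝ) → Matrix (Fin n) (Fin n) ℝ}
  {ε Λ : ℝ} {V : (Fin n → ℝ) → ℝ} {μ : ℝ → ℝ}

/-- The metric `e^{-4V} h`, conformal to the quotient metric of a seed. -/
def quotientMetric (V : (Fin n → ℝ) → ℝ) (h : (Fin n → ℝ) → Matrix (Fin n) (Fin n) ℝ) :
    (Fin n → ℝ) → Matrix (Fin n) (Fin n) ℝ :=
  conformal (fun x => -2 * V x) h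

theorem orthMetric_eq_inflatedMetric (ε : ℝ) (V : (Fin n → ℝ) → ℝ)
    (h : (Fin n → ℝ) → Matrix (Fin n) (Fin n) ℝ) :
    orthMetric ε V h = inflatedMetric ε 1 0 (fun _ => 0) V (quotientMetric V h) := by
  rw [← Template.trivial_metric, Template.metric_eq_inflatedMetric]
  simp [Template.trivial, quotientMetric]

theorem orthMetric_succ_succ (p : Fin (n + 1) → ℝ) (i j : Fin n) :
    orthMetric ε V h p i.succ j.succ
      = Real.exp (2 * V (Fin.tail p)) * quotientMetric V h (Fin.tail p) i j := by
  simp only [orthMetric, blockForm_succ_succ, quotientMetric, conformal, Matrix.smul_apply,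
    smul_eq_mul, ← mul_assoc, ← Real.exp_add]
  ring_nf

/-- Symmetry and nondegeneracy of h are read off from the spatial block of the Lorentzian seed on
the slice y = 0. -/
theorem IsSeed.regular (hs : IsSeed ε Λ Ω V h) : RegularOn Ω h where
  smooth := hs.smooth_metric
  symm x hx i j := by
    have hL := hs.vacuum.metric.lorentzian (Fin.cons 0 x) ⟨trivial, by simpa using hx⟩
    have := congrFun (congrFun hL.symm j.succ) i.succ
    simpa [orthMetric] using this
  nondeg x hx := by
    have hL := hs.vacuum.metric.lorentzian (Fin.cons 0 x) ⟨trivial, by simpa using hx⟩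
    have := isUnit_det_of_blockForm hL.isUnit_det
    rw [Matrix.det_smul, Fin.tail_cons] at this
    exact isUnit_of_mul_isUnit_right this

theorem RegularOn.quotient (hh : RegularOn Ω h) (hV : ContDiffOn ℝ ∞ V Ω) :
    RegularOn Ω (quotientMetric V h) :=
  hh.conformal_metric (contDiffOn_const.mul hV)

/-- The vacuum equations of `g[V, h]`, reduced to the quotient. -/
theorem vacuum_iff (hΩ : IsOpen Ω) (hV : ContDiffOn ℝ ∞ V Ω) (hh : RegularOn Ω h)
    (hε : ε * ε = 1) (K : ℝ) :
    (∀ p ∈ domain Set.univ Ω, ∀ a b,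
      ricci (orthMetric ε V h) p a b = K * orthMetric ε V h p a b) ↔
    ∀ x ∈ Ω, box (quotientMetric V h) V x + (n - 1) * gradInner (quotientMetric V h) V V x
        = -(K * Real.exp (2 * V x)) ∧
      ∀ i j, ricci (quotientMetric V h) x i j
        = (n - 1) * (hess (quotientMetric V h) V x i j - pderiv i V x * pderiv j V x) := by
  have hq := hh.quotient hV
  have hμ : ContDiffOn ℝ ∞ (fun _ : ℝ => (0 : ℝ)) Set.univ := contDiffOn_const
  -- These four components are the case α = 1, τ = 0, μ = 0 of the general formulas.
  have r00 : ∀ p ∈ domain Set.univ Ω, ricci (orthMetric ε V h) p 0 0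
      = -ε * (box (quotientMetric V h) V (Fin.tail p)
        + (n - 1) * gradInner (quotientMetric V h) V V (Fin.tail p)) := by
    intro p hp
    rw [orthMetric_eq_inflatedMetric,
      ricci_inflatedMetric_zero_zero isOpen_univ hΩ hV hμ hq hε 1 0 hp]
    simp
  have r0i : ∀ p ∈ domain Set.univ Ω, ∀ i : Fin n,
      ricci (orthMetric ε V h) p 0 i.succ = 0 := by
    intro p hp i
    rw [orthMetric_eq_inflatedMetric,
      ricci_inflatedMetric_zero_succ isOpen_univ hΩ hV hμ hq hε 1 0 hp]
    simp
  have ri0 : ∀ p ∈ domain Set.univ Ω, ∀ i : Fin n,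
      ricci (orthMetric ε V h) p i.succ 0 = 0 := by
    intro p hp i
    rw [orthMetric_eq_inflatedMetric,
      ricci_inflatedMetric_succ_zero isOpen_univ hΩ hV hμ hq hε 1 0 hp]
    simp
  have rij : ∀ p ∈ domain Set.univ Ω, ∀ i j : Fin n,
      ricci (orthMetric ε V h) p i.succ j.succ = ricci (quotientMetric V h) (Fin.tail p) i j
        - (n - 1) * (hess (quotientMetric V h) V (Fin.tail p) i j
          - pderiv i V (Fin.tail p) * pderiv j V (Fin.tail p))
        - quotientMetric V h (Fin.tail p) i j * (box (quotientMetric V h) V (Fin.tail p)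
        + (n - 1) * gradInner (quotientMetric V h) V V (Fin.tail p)) := by
    intro p hp i j
    rw [orthMetric_eq_inflatedMetric,
      ricci_inflatedMetric_succ_succ isOpen_univ hΩ hV hμ hq hε 1 0 hp]
    simp
    ring
  have hε0 : ε ≠ 0 := left_ne_zero_of_mul_eq_one hε
  constructor
  · intro H x hx
    have hp : (Fin.cons 0 x : Fin (n + 1) → ℝ) ∈ domain Set.univ Ω :=
      ⟨trivial, by simpa using hx⟩
    have h1 : box (quotientMetric V h) V x + (n - 1) * gradInner (quotientMetric V h) V V x
        = -(K * Real.exp (2 * V x)) := by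
      have := H _ hp 0 0
      rw [r00 _ hp] at this
      simp only [orthMetric, blockForm_zero_zero, Fin.tail_cons] at this
      apply mul_left_cancel₀ hε0
      linarith
    -- By the yy equation the trace term proportional to q equals K times the spatial metric, so it
    -- drops out of the spatial equation.
    refine ⟨h1, fun i j => ?_⟩
    have := H _ hp i.succ j.succ
    rw [rij _ hp, orthMetric_succ_succ, Fin.tail_cons, h1] at this
    linarith
  · intro H p hp a b
    obtain ⟨h1, h2⟩ := H _ hp.2
    refine Fin.cases ?_ (fun i => ?_) a <;> refine Fin.cases ?_ (fun j => ?_) b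
    · rw [r00 p hp, h1]; simp only [orthMetric, blockForm_zero_zero]; ring
    · rw [r0i p hp]; simp [orthMetric]
    · rw [ri0 p hp]; simp [orthMetric]
    · rw [rij p hp, orthMetric_succ_succ, h1, h2]; ring

/-- The proportionality constant `2Λ / (N - 2)` of the vacuum equations, `N = n + 1`. -/
def einsteinConst (n : ℕ) (Λ : ℝ) : ℝ := 2 / (((n + 1 : ℕ) : ℝ) - 2) * Λ

theorem IsSeed.vacuum' (hs : IsSeed ε Λ Ω V h) (hε : ε * ε = 1) :
    ∀ x ∈ Ω, box (quotientMetric V h) V x + (n - 1) * gradInner (quotientMetric V h) V V x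
        = -(einsteinConst n Λ * Real.exp (2 * V x)) ∧
      ∀ i j, ricci (quotientMetric V h) x i j
        = (n - 1) * (hess (quotientMetric V h) V x i j - pderiv i V x * pderiv j V x) := by
  rw [← vacuum_iff hs.isOpen hs.smooth_potential hs.regular hε]
  intro p hp a b
  rw [hs.vacuum.vacuum p hp, einsteinConst]; ring

/-- The value `β ⟨∇V, ∇V⟩ - 2Λ / (N - 2) e^{2V}` of `□V + (n - 1 + β) ⟨∇V, ∇V⟩` on a seed. -/
def sourceTerm (n : ℕ) (Λ β : ℝ) (V : (Fin n → ℝ) → ℝ)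
    (h : (Fin n → ℝ) → Matrix (Fin n) (Fin n) ℝ) (x : Fin n → ℝ) : ℝ :=
  β * gradInner (quotientMetric V h) V V x - einsteinConst n Λ * Real.exp (2 * V x)

/-- The exponent `τ` of the conformal factor `e^{2τV}` that a template applies to the
quotient metric. -/
def Template.τ (T : Template) : ℝ := 2 - 2 * T.α - T.δ

/-- The deviation of a template from the transformation weight. -/
def Template.β (n : ℕ) (T : Template) : ℝ := (n - 2) * T.τ + (n - 1) * T.α - (n - 1)

/-- At each point the template metric is congruent to the seed metric through a block-scalar matrix
with positive entries, so the signature is inherited. -/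
theorem Template.metric_isMetricOn (T : Template) (hs : IsSeed ε Λ Ω V h)
    (hμ : ContDiffOn ℝ ∞ T.μ I) (hε : ε * ε = 1) : IsMetricOn (domain I Ω) (T.metric ε V h) where
  smooth := by
    have hε0 : ε ≠ 0 := left_ne_zero_of_mul_eq_one hε
    have hq := hs.regular.quotient hs.smooth_potential
    have hτ : ContDiffOn ℝ ∞ (fun x => (2 - 2 * T.α - T.δ) * V x) Ω :=
      contDiffOn_const.mul hs.smooth_potential
    rw [T.metric_eq_inflatedMetric]
    exact (((hq.conformal_metric hτ).product hε0).conformal_metric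
      (contDiffOn_sepField hs.smooth_potential hμ _ _)).smooth
  lorentzian p hp := by
    have hL := hs.vacuum.metric.lorentzian p ⟨Set.mem_univ _, hp.2⟩
    have e : T.metric ε V h p
        = (blockForm (Real.exp (T.μ (p 0) + T.α * V (Fin.tail p) - V (Fin.tail p)))
            (Real.exp (T.μ (p 0) - T.α * V (Fin.tail p) - T.δ * V (Fin.tail p) + V (Fin.tail p))
              • (1 : Matrix (Fin n) (Fin n) ℝ)))ᵀ
          * orthMetric ε V h p
          * blockForm (Real.exp (T.μ (p 0) + T.α * V (Fin.tail p) - V (Fin.tail p)))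
            (Real.exp (T.μ (p 0) - T.α * V (Fin.tail p) - T.δ * V (Fin.tail p) + V (Fin.tail p))
              • (1 : Matrix (Fin n) (Fin n) ℝ)) := by
      rw [blockForm_transpose, orthMetric, blockForm_mul, blockForm_mul, Template.metric,
        orthMetric, smul_blockForm]
      simp only [Matrix.transpose_smul, Matrix.transpose_one, Matrix.smul_mul, Matrix.mul_smul,
        Matrix.one_mul, Matrix.mul_one, smul_smul]
      congr 1
      · rw [mul_left_comm, mul_left_comm _ ε, mul_assoc, ← Real.exp_add, ← Real.exp_add,
          ← Real.exp_add]
        ring_nf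
      · simp only [← Real.exp_add]
        ring_nf
    rw [e]
    refine hL.congruence (isUnit_det_blockForm (Real.exp_ne_zero _) ?_)
    rw [Matrix.det_smul, Matrix.det_one, mul_one]
    exact (Real.exp_ne_zero _).isUnit.pow _

/-- The Einstein-scalar field equations of a template with vanishing potential, reduced to the
quotient metric of the seed. -/
theorem Template.solution_iff (T : Template) {κ : ℝ} (hs : IsSeed ε Λ Ω V h) (hI : IsOpen I)
    (hμ : ContDiffOn ℝ ∞ T.μ I) (hε : ε * ε = 1) :
    IsEinsteinScalarSolution κ (fun _ => 0) (domain I Ω) (T.metric ε V h) (T.field V) ↔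
    ∀ y ∈ I, ∀ x ∈ Ω,
      -n * deriv (deriv T.μ) y
          - ε * T.α * (Real.exp (2 * (T.τ * V x)))⁻¹ * sourceTerm n Λ (T.β n) V h x
        = κ * (T.ρ ^ 2 * deriv T.μ y ^ 2) ∧
      (∀ i, (n - 1) * T.α * (deriv T.μ y * pderiv i V x)
        = κ * (T.σ * T.ρ * (deriv T.μ y * pderiv i V x))) ∧
      (∀ i j, -T.β n * hess (quotientMetric V h) V x i j
          + ((n - 2) * T.τ ^ 2 + (n - 1) * (T.α ^ 2 + 2 * T.α * T.τ) - (n - 1))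
            * (pderiv i V x * pderiv j V x)
          - quotientMetric V h x i j * ((T.τ + T.α) * sourceTerm n Λ (T.β n) V h x
            + Real.exp (2 * (T.τ * V x)) * ε
              * (deriv (deriv T.μ) y + (n - 1) * deriv T.μ y ^ 2))
        = κ * (T.σ ^ 2 * (pderiv i V x * pderiv j V x))) ∧
      T.ρ * ε * (deriv (deriv T.μ) y + (n - 1) * deriv T.μ y ^ 2)
        + T.σ * (Real.exp (2 * (T.τ * V x)))⁻¹ * sourceTerm n Λ (T.β n) V h x = 0 := by
  have hΩ := hs.isOpen
  have hV := hs.smooth_potential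
  have hq := hs.regular.quotient hV
  -- All components contain V's d'Alembertian only in this combination. The seed supplies it with
  -- coefficient n - 1 in front of |∇V|², and β is the excess over n - 1.
  have src : ∀ x ∈ Ω, box (quotientMetric V h) V x
      + ((n - 2) * T.τ + (n - 1) * T.α) * gradInner (quotientMetric V h) V V x
      = sourceTerm n Λ (T.β n) V h x := by
    intro x hx
    rw [sourceTerm, Template.β]
    linear_combination (hs.vacuum' hε x hx).1
  have hm : T.metric ε V h = inflatedMetric ε T.α T.τ T.μ V (quotientMetric V h) :=
    T.metric_eq_inflatedMetric ε V h
  have hβ : T.β n = (n - 2) * T.τ + (n - 1) * T.α - (n - 1) := rfl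
  have hf : T.field V = sepField T.σ V T.ρ T.μ := rfl
  have scal : ∀ p ∈ domain I Ω, (box (T.metric ε V h) (T.field V) p
      - deriv (fun _ : ℝ => (0 : ℝ)) (T.field V p) = 0 ↔
        T.ρ * ε * (deriv (deriv T.μ) (p 0) + (n - 1) * deriv T.μ (p 0) ^ 2)
        + T.σ * (Real.exp (2 * (T.τ * V (Fin.tail p))))⁻¹
          * sourceTerm n Λ (T.β n) V h (Fin.tail p) = 0) := by
    intro p hp
    rw [hm, hf, box_inflatedMetric hI hΩ hV hμ hq hε _ _ hp, src _ hp.2]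
    simp [Real.exp_ne_zero]
  constructor
  · intro H y hy x hx
    have hp : (Fin.cons y x : Fin (n + 1) → ℝ) ∈ domain I Ω := by
      constructor <;> simpa
    have hE := H.einstein _ hp
    have hS := (scal _ hp).1 (H.scalar _ hp)
    simp only [hm, hf, mul_zero, add_zero] at hE
    refine ⟨?_, fun i => ?_, fun i j => ?_, ?_⟩
    · have := hE 0 0
      rw [ricci_inflatedMetric_zero_zero hI hΩ hV hμ hq hε _ _ hp,
        pderiv_zero_sepField hI hΩ hV hμ _ _ hp, src _ hp.2] at this
      simp only [Fin.tail_cons, Fin.cons_zero] at this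
      rw [this]; ring
    · have := hE 0 i.succ
      rw [ricci_inflatedMetric_zero_succ hI hΩ hV hμ hq hε _ _ hp,
        pderiv_zero_sepField hI hΩ hV hμ _ _ hp, pderiv_succ_sepField hI hΩ hV hμ _ _ hp] at this
      simp only [Fin.tail_cons, Fin.cons_zero] at this
      rw [this]; ring
    · have := hE i.succ j.succ
      rw [ricci_inflatedMetric_succ_succ hI hΩ hV hμ hq hε _ _ hp,
        pderiv_succ_sepField hI hΩ hV hμ _ _ hp, pderiv_succ_sepField hI hΩ hV hμ _ _ hp,
        src _ hp.2] at this
      simp only [Fin.tail_cons, Fin.cons_zero] at this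
      rw [(hs.vacuum' hε x hx).2] at this
      linear_combination this - hess (quotientMetric V h) V x i j * hβ
    · simpa using hS
  · intro H
    refine ⟨T.metric_isMetricOn hs hμ hε, contDiffOn_sepField hV hμ _ _, ?_, ?_⟩
    · intro p hp a b
      obtain ⟨h00, h0i, hij, -⟩ := H _ hp.1 _ hp.2
      simp only [hm, hf, mul_zero, add_zero]
      refine Fin.cases ?_ (fun i => ?_) a <;> refine Fin.cases ?_ (fun j => ?_) b
      · rw [ricci_inflatedMetric_zero_zero hI hΩ hV hμ hq hε _ _ hp,
          pderiv_zero_sepField hI hΩ hV hμ _ _ hp, src _ hp.2, h00]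
        ring
      · rw [ricci_inflatedMetric_zero_succ hI hΩ hV hμ hq hε _ _ hp,
          pderiv_zero_sepField hI hΩ hV hμ _ _ hp, pderiv_succ_sepField hI hΩ hV hμ _ _ hp, h0i]
        ring
      · rw [ricci_inflatedMetric_succ_zero hI hΩ hV hμ hq hε _ _ hp,
          pderiv_zero_sepField hI hΩ hV hμ _ _ hp, pderiv_succ_sepField hI hΩ hV hμ _ _ hp, h0i]
        ring
      · have := hij i j
        rw [ricci_inflatedMetric_succ_succ hI hΩ hV hμ hq hε _ _ hp,
          pderiv_succ_sepField hI hΩ hV hμ _ _ hp, pderiv_succ_sepField hI hΩ hV hμ _ _ hp,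
          src _ hp.2, (hs.vacuum' hε _ hp.2).2]
        linear_combination this + hess (quotientMetric V h) V (Fin.tail p) i j * hβ
    · intro p hp
      exact (scal p hp).2 (H _ hp.1 _ hp.2).2.2.2

end Seed

/-! ### The explicit family and its verification. -/

section Family

variable {n : ℕ} {I : Set ℝ} {Ω : Set (Fin n → ℝ)} {h : (Fin n → ℝ) → Matrix (Fin n) (Fin n) ℝ}
  {ε Λ κ : ℝ} {V : (Fin n → ℝ) → ℝ} {μ : ℝ → ℝ} {T : Template}

/-- Expanding the definitions, β = (n-3)(1-α) - (n-2)δ. -/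
theorem Template.isTransformation_iff (hn : 3 ≤ n) :
    T.IsTransformation (n + 1) ↔ T.β n = 0 := by
  have hn' : (3 : ℝ) ≤ n := by exact_mod_cast hn
  have h2 : (n : ℝ) - 2 ≠ 0 := by linarith
  have e1 : ((n + 1 : ℕ) : ℝ) - 3 = n - 2 := by push_cast; ring
  have e2 : ((n + 1 : ℕ) : ℝ) - 4 = n - 3 := by push_cast; ring
  rw [Template.IsTransformation, Template.β, Template.τ, e1, e2, div_mul_eq_mul_div, eq_div_iff h2]
  constructor <;> intro H <;> linarith

theorem Template.metric_eq_blockForm (T : Template) (ε : ℝ) (V : (Fin n → ℝ) → ℝ)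
    (h : (Fin n → ℝ) → Matrix (Fin n) (Fin n) ℝ) (p : Fin (n + 1) → ℝ) :
    T.metric ε V h p = blockForm (ε * Real.exp (2 * (T.α * V (Fin.tail p) + T.μ (p 0))))
      (Real.exp (-2 * (T.α + T.δ) * V (Fin.tail p) + 2 * T.μ (p 0)) • h (Fin.tail p)) := by
  simp only [Template.metric, orthMetric, smul_blockForm, smul_smul, ← Real.exp_add]
  congr 1
  · rw [mul_left_comm, ← Real.exp_add]; ring_nf
  · ring_nf

/-- The Jacobian of the reparametrization is diagonal with entries s, 1, …, 1. -/
theorem pullback_reparam_blockForm (s y₀ : ℝ) (a : (Fin (n + 1) → ℝ) → ℝ)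
    (B : (Fin (n + 1) → ℝ) → Matrix (Fin n) (Fin n) ℝ) (p : Fin (n + 1) → ℝ) :
    pullback (reparam s y₀) (fun q => blockForm (a q) (B q)) p
      = blockForm (s ^ 2 * a (reparam s y₀ p)) (B (reparam s y₀ p)) := by
  have d0 : ∀ i, pderiv i (fun q : Fin (n + 1) → ℝ => reparam s y₀ q 0) p
      = if i = 0 then s else 0 := by
    intro i
    have hd : HasDerivAt (fun y : ℝ => s * (y - y₀)) s (p 0) := by
      simpa using ((hasDerivAt_id (p 0)).sub_const y₀).const_mul s
    have := pderiv_comp_coord (0 : Fin (n + 1)) (p := p) hd.differentiableAt i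
    rw [hd.deriv] at this
    exact this
  have d1 : ∀ i (j : Fin n), pderiv i (fun q : Fin (n + 1) → ℝ => reparam s y₀ q j.succ) p
      = if i = j.succ then 1 else 0 := by
    intro i j
    have := pderiv_comp_coord j.succ (p := p) (f := fun y => y) differentiableAt_id i
    rw [deriv_id''] at this
    exact this
  have hk : ∀ k : Fin n, (0 : Fin (n + 1)) ≠ k.succ := fun k => (Fin.succ_ne_zero k).symm
  ext i j
  simp only [pullback, Matrix.of_apply, Fin.sum_univ_succ, d0, d1]
  refine Fin.cases ?_ (fun i => ?_) i <;> refine Fin.cases ?_ (fun j => ?_) j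
  · simp [hk, sq, mul_assoc]
  · simp [hk]
  · simp [hk]
  · simp

section Numerics

variable {e : ℝ}

/-- The template parameters of the family, in closed form. -/
structure IsFamilyTemplate (n : ℕ) (κ e : ℝ) (T : Template) : Prop where
  alpha : T.α = 1 / ((n : ℝ) - 1)
  delta : T.δ = ((n : ℝ) - 3) / (n - 2) * (1 - 1 / ((n : ℝ) - 1))
  sigma : T.σ = e * √(n / (κ * (n - 1)))
  rho : T.ρ = e * √((n - 1) / (κ * n))

theorem familyAlpha_succ : familyAlpha (n + 1) = 1 / ((n : ℝ) - 1) := by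
  rw [familyAlpha]; push_cast; congr 1; ring

/-- Since e² = 1, this product is σρ; it gives κσρ = 1, which the mixed Einstein equation demands
when (n-1)α = 1. -/
theorem sqrt_family_mul (hn : 3 ≤ n) (hκ : 0 < κ) :
    √((n : ℝ) / (κ * (n - 1))) * √(((n : ℝ) - 1) / (κ * n)) = 1 / κ := by
  have hn' : (3 : ℝ) ≤ n := by exact_mod_cast hn
  have h1 : (0 : ℝ) < n - 1 := by linarith
  have h0 : (0 : ℝ) < n := by linarith
  rw [← Real.sqrt_mul (by positivity)]
  have : (n : ℝ) / (κ * (n - 1)) * ((n - 1) / (κ * n)) = (1 / κ) ^ 2 := by field_simp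
  rw [this, Real.sqrt_sq (by positivity)]

theorem IsFamilyTemplate.hasFamilyParameters (hT : IsFamilyTemplate n κ e T) (hn : 3 ≤ n)
    (hκ : 0 < κ) (he : e = 1 ∨ e = -1) :
    HasFamilyParameters (n + 1) κ e (e / √(((n + 1 : ℕ) : ℝ) - 1)) T := by
  have hn' : (3 : ℝ) ≤ n := by exact_mod_cast hn
  have h1 : (0 : ℝ) < n - 1 := by linarith
  have h0 : (0 : ℝ) < n := by linarith
  have hs : 0 < √(n : ℝ) := Real.sqrt_pos.2 h0
  have hs2 : √(n : ℝ) ^ 2 = n := Real.sq_sqrt h0.le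
  have he2 : e ^ 2 = 1 := by rcases he with rfl | rfl <;> norm_num
  have e1 : ((n + 1 : ℕ) : ℝ) - 1 = n := by push_cast; ring
  have e2 : ((n + 1 : ℕ) : ℝ) - 2 = n - 1 := by push_cast; ring
  -- With λ² = 1/n the radicand n - 2 + 1/n is (n-1)²/n, whose numerator is a perfect square; this
  -- is why α is rational.
  have e3 : ((n + 1 : ℕ) : ℝ) - 3 + (e / √(n : ℝ)) ^ 2 = (n - 1) ^ 2 / n := by
    rw [div_pow, he2, hs2]; push_cast; field_simp; ring
  rw [e1]
  refine ⟨by rw [e1], ?_, ?_, ?_, ?_, ?_⟩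
  · rw [hT.alpha, e3, Real.sqrt_div (by positivity), Real.sqrt_sq h1.le]
    field_simp
    linarith
  · rw [hT.alpha, familyAlpha_succ]
  · rw [hT.delta, hT.alpha]; push_cast; congr 2 <;> ring
  · rw [hT.sigma, e3, e2]
    congr 2
    field_simp
  · rw [hT.rho, e2]
    have : ((n : ℝ) - 1) / (κ * n) = (n - 1) / κ / n := by rw [div_div]
    rw [this, Real.sqrt_div (by positivity)]
    ring

theorem IsFamilyTemplate.metric_eq (hT : IsFamilyTemplate n κ e T) (χ : ℝ)
    {p : Fin (n + 1) → ℝ} {Y : ℝ} (hY : T.μ (p 0) = √(-χ) * Y) :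
    T.metric ε V h p = familyMetric ε χ V h (Fin.cons Y (Fin.tail p)) := by
  rw [T.metric_eq_blockForm, familyMetric, familyGamma, familyAlpha_succ, hT.alpha, hT.delta, hY]
  simp only [Fin.tail_cons, Fin.cons_zero]
  congr 3
  · push_cast
    rw [show (n : ℝ) + 1 - 4 = n - 3 by ring, show (n : ℝ) + 1 - 3 = n - 2 by ring]
    ring

theorem IsFamilyTemplate.field_eq (hT : IsFamilyTemplate n κ e T) (hn : 3 ≤ n) (hκ : 0 < κ)
    (χ : ℝ) {p : Fin (n + 1) → ℝ} {Y : ℝ} (hY : T.μ (p 0) = √(-χ) * Y) :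
    T.field V p = familyField κ e χ V (Fin.cons Y (Fin.tail p)) := by
  have hn' : (3 : ℝ) ≤ n := by exact_mod_cast hn
  have h1 : (0 : ℝ) < n - 1 := by linarith
  have h0 : (0 : ℝ) < n := by linarith
  have e1 : ((n + 1 : ℕ) : ℝ) - 1 = n := by push_cast; ring
  have e2 : ((n + 1 : ℕ) : ℝ) - 2 = n - 1 := by push_cast; ring
  have hm := sqrt_family_mul hn hκ
  have hsq : √((n : ℝ) / (κ * (n - 1))) ^ 2 = n / (κ * (n - 1)) := Real.sq_sqrt (by positivity)
  have hpos : 0 < √((n : ℝ) / (κ * (n - 1))) := Real.sqrt_pos.2 (by positivity)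
  -- The ratio ρ/σ = (n-1)/n lets the common square root be factored out of the field.
  have key : √(((n : ℝ) - 1) / (κ * n)) = √((n : ℝ) / (κ * (n - 1))) * ((n - 1) / n) := by
    apply mul_left_cancel₀ hpos.ne'
    rw [hm, ← mul_assoc, ← sq, hsq]
    field_simp
  rw [Template.field, familyField, hT.sigma, hT.rho, hY, e1, e2, key]
  simp only [Fin.tail_cons, Fin.cons_zero]
  ring

theorem IsFamilyTemplate.τ_eq (hT : IsFamilyTemplate n κ e T) (hn : 3 ≤ n) : T.τ = 1 := by
  have hn' : (3 : ℝ) ≤ n := by exact_mod_cast hn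
  have h1 : (n : ℝ) - 1 ≠ 0 := by linarith
  have h2 : (n : ℝ) - 2 ≠ 0 := by linarith
  rw [Template.τ, hT.alpha, hT.delta]
  field_simp
  ring

theorem IsFamilyTemplate.β_eq (hT : IsFamilyTemplate n κ e T) (hn : 3 ≤ n) : T.β n = 0 := by
  have hn' : (3 : ℝ) ≤ n := by exact_mod_cast hn
  have h1 : (n : ℝ) - 1 ≠ 0 := by linarith
  rw [Template.β, hT.τ_eq hn, hT.alpha]
  field_simp
  ring

end Numerics

theorem einsteinConst_familyCosm (hn : 3 ≤ n) (χ : ℝ) :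
    einsteinConst n (familyCosm (n + 1) ε χ) = -ε * ((n - 1) ^ 2 / n) * χ := by
  have hn' : (3 : ℝ) ≤ n := by exact_mod_cast hn
  have h1 : (n : ℝ) - 1 ≠ 0 := by linarith
  have h0 : (n : ℝ) ≠ 0 := by linarith
  have e1 : ((n + 1 : ℕ) : ℝ) - 1 = n := by push_cast; ring
  have e2 : ((n + 1 : ℕ) : ℝ) - 2 = n - 1 := by push_cast; ring
  rw [einsteinConst, familyCosm, e1, e2]
  field_simp

/-- The templates of the family solve the field equations. -/
theorem IsFamilyTemplate.solution {e χ : ℝ} (hT : IsFamilyTemplate n κ e T) (hn : 3 ≤ n)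
    (hκ : 0 < κ) (he : e = 1 ∨ e = -1) (hε : ε * ε = 1) (hχ : χ < 0)
    (hs : IsSeed ε (familyCosm (n + 1) ε χ) Ω V h) (hI : IsOpen I)
    (hμ : T.μ = fun y => √(-χ) * y) :
    IsEinsteinScalarSolution κ (fun _ => 0) (domain I Ω) (T.metric ε V h) (T.field V) := by
  have hn' : (3 : ℝ) ≤ n := by exact_mod_cast hn
  have h1 : (0 : ℝ) < n - 1 := by linarith
  have h0 : (0 : ℝ) < n := by linarith
  have he2 : e ^ 2 = 1 := by rcases he with rfl | rfl <;> norm_num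
  have hd : deriv T.μ = fun _ => √(-χ) := by
    rw [hμ]; funext y; simp
  have hχ2 : √(-χ) ^ 2 = -χ := Real.sq_sqrt (by linarith)
  have hσρ : κ * (T.σ * T.ρ) = 1 := by
    rw [hT.sigma, hT.rho, mul_mul_mul_comm, ← sq e, he2, sqrt_family_mul hn hκ]
    field_simp
  have hσ : κ * T.σ ^ 2 = n / (n - 1) := by
    rw [hT.sigma, mul_pow, he2, Real.sq_sqrt (by positivity)]; field_simp
  have hρ : κ * T.ρ ^ 2 = (n - 1) / n := by
    rw [hT.rho, mul_pow, he2, Real.sq_sqrt (by positivity)]; field_simp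
  -- This linear relation is what the scalar equation reduces to; it follows from the two quadratic
  -- ones after cancelling κσ ≠ 0.
  have hσρ' : T.σ * (n - 1) = T.ρ * n := by
    have : κ * T.σ * (T.σ * (n - 1) - T.ρ * n) = 0 := by
      have hx : κ * T.σ ^ 2 * (n - 1) = n := by rw [hσ]; field_simp
      linear_combination hx - n * hσρ
    have hne : κ * T.σ ≠ 0 := by
      intro h'
      rw [← mul_assoc, h', zero_mul] at hσρ
      exact zero_ne_one hσρ
    rcases mul_eq_zero.1 this with h' | h'
    · exact absurd h' hne
    · linarith
  rw [T.solution_iff hs hI (by rw [hμ]; exact (contDiff_const.mul contDiff_id).contDiffOn) hε]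
  intro y hy x hx
  -- With β = 0 the source is -K e^{2V}, and τ = 1 makes its exponential cancel against the
  -- conformal factor, so purely numerical identities are left.
  simp only [hd, deriv_const', sourceTerm, hT.β_eq hn, hT.τ_eq hn, hT.alpha, hχ2,
    einsteinConst_familyCosm hn, one_mul, zero_mul, neg_zero, zero_sub, mul_zero, zero_add]
  have hE := Real.exp_ne_zero (2 * V x)
  refine ⟨?_, fun i => ?_, fun i j => ?_, ?_⟩
  · rw [← mul_assoc, hρ]
    field_simp
    linear_combination (-χ) * hε
  · rw [← mul_assoc κ, hσρ]
    field_simp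
  · rw [← mul_assoc κ, hσ]
    field_simp
    ring
  · field_simp
    linear_combination ε * χ * (n - 1) * hσρ'

end Family

/-! ### Transformation templates belong to the family. -/

section Converse

variable {n : ℕ} {I : Set ℝ} {Ω : Set (Fin n → ℝ)} {h : (Fin n → ℝ) → Matrix (Fin n) (Fin n) ℝ}
  {ε Λ κ : ℝ} {V : (Fin n → ℝ) → ℝ} {T : Template}

theorem familyCosm_injective (hn : 3 ≤ n) (hε : ε * ε = 1) :
    Function.Injective (familyCosm (n + 1) ε) := by
  intro χ χ' H
  have hn' : (3 : ℝ) ≤ n := by exact_mod_cast hn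
  have hε0 : ε ≠ 0 := left_ne_zero_of_mul_eq_one hε
  have e1 : ((n + 1 : ℕ) : ℝ) - 1 = n := by push_cast; ring
  have e2 : ((n + 1 : ℕ) : ℝ) - 2 = n - 1 := by push_cast; ring
  have h1 : (n : ℝ) - 1 ≠ 0 := by linarith
  have h0 : (n : ℝ) ≠ 0 := by linarith
  rw [familyCosm, familyCosm, e1, e2] at H
  refine mul_left_cancel₀ ?_ H
  exact mul_ne_zero (neg_ne_zero.2 (div_ne_zero hε0 two_ne_zero))
    (div_ne_zero (pow_ne_zero _ h1) h0)

theorem IsFamilyTemplate.isFamilyMember {e χ s y₀ : ℝ} (hT : IsFamilyTemplate n κ e T)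
    (hn : 3 ≤ n) (hκ : 0 < κ) (he : e = 1 ∨ e = -1) (hχ : χ < 0)
    (hΛ : Λ = familyCosm (n + 1) ε χ) (hs : s = 1 ∨ s = -1)
    (hμ : ∀ y ∈ I, T.μ y = √(-χ) * (s * (y - y₀))) : IsFamilyMember n ε κ Λ I T χ := by
  refine ⟨hχ, hΛ, e, s, y₀, _, he, hs, hT.hasFamilyParameters hn hκ he, hμ, ?_⟩
  intro V h p hp
  have hs2 : s ^ 2 = 1 := by rcases hs with rfl | rfl <;> norm_num
  refine ⟨?_, hT.field_eq hn hκ χ (hμ _ hp)⟩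
  have := pullback_reparam_blockForm s y₀
    (fun p => ε * Real.exp (2 * (familyAlpha (n + 1) * V (Fin.tail p) + √(-χ) * p 0)))
    (fun p => Real.exp (-2 * familyGamma (n + 1) * V (Fin.tail p) + 2 * √(-χ) * p 0) •
      h (Fin.tail p)) p
  rw [hs2, one_mul] at this
  rw [hT.metric_eq χ (hμ _ hp)]
  exact this.symm

/-- A nondegenerate form on a space of dimension at least two is not proportional to a square. -/
theorem RegularOn.eq_zero_of_rank_one {ι : Type*} [Fintype ι] [DecidableEq ι] {D : Set (ι → ℝ)}
    {g : (ι → ℝ) → Matrix ι ι ℝ} (hg : RegularOn D g) {p : ι → ℝ} (hp : p ∈ D) {k l : ι}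
    (hkl : k ≠ l) {X Y : ℝ} {v : ι → ℝ} (H : ∀ i j, X * (v i * v j) = g p i j * Y) : Y = 0 := by
  -- Raising one index turns the hypothesis into: Y times the identity matrix has rank at most one.
  have key : ∀ a b, (if a = b then (1 : ℝ) else 0) * Y = X * (∑ c, (g p)⁻¹ a c * v c) * v b := by
    intro a b
    rw [← hg.sum_inv_mul hp a b, Finset.sum_mul, Finset.mul_sum, Finset.sum_mul]
    exact Finset.sum_congr rfl fun c _ => by linear_combination -(g p)⁻¹ a c * H c b
  have h1 := key k k
  have h2 := key l l
  have h3 := key k l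
  have h4 := key l k
  rw [if_pos rfl, one_mul] at h1 h2
  rw [if_neg hkl, zero_mul] at h3
  rw [if_neg hkl.symm, zero_mul] at h4
  -- The 2 × 2 minor on the indices k, l vanishes.
  have : Y * Y = 0 := by
    calc Y * Y = (X * (∑ c, (g p)⁻¹ k c * v c) * v l) * (X * (∑ c, (g p)⁻¹ l c * v c) * v k) := by
          rw [mul_mul_mul_comm, mul_comm (v l), ← mul_mul_mul_comm, ← h1, ← h2]
      _ = 0 := by rw [← h3, zero_mul]
  exact mul_self_eq_zero.1 this

/-- The potential of a seed with `Λ ≠ 0` is not constant. -/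
theorem IsSeed.exists_pderiv_ne_zero (hs : IsSeed ε Λ Ω V h) (hε : ε * ε = 1) (hn : 3 ≤ n)
    (hΛ : Λ ≠ 0) : ∃ x ∈ Ω, ∃ i, pderiv i V x ≠ 0 := by
  by_contra! H
  obtain ⟨x, hx⟩ := hs.connected.nonempty
  have h1 := (hs.vacuum' hε x hx).1
  have hb : box (quotientMetric V h) V x = 0 := by
    rw [box]
    refine Finset.sum_eq_zero fun i _ => Finset.sum_eq_zero fun j _ => ?_
    rw [pderiv_congr hs.isOpen hx (fun z hz => H z hz j), pderiv_const]
    simp [H x hx]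
  have hg : gradInner (quotientMetric V h) V V x = 0 := by
    simp [gradInner, H x hx]
  have hn' : (3 : ℝ) ≤ n := by exact_mod_cast hn
  have e2 : ((n + 1 : ℕ) : ℝ) - 2 = n - 1 := by push_cast; ring
  have hn1 : (n : ℝ) - 1 ≠ 0 := by linarith
  rw [hb, hg, einsteinConst, e2] at h1
  have := Real.exp_ne_zero (2 * V x)
  simp [hΛ, hn1] at h1

/-- A smooth function on an interval with constant squared derivative is affine. -/
theorem affine_of_deriv_sq {μ : ℝ → ℝ} (hI : IsOpen I) (hc : IsConnected I)
    (hμ : ContDiffOn ℝ ∞ μ I) {c : ℝ} (hc0 : 0 < c) (H : ∀ y ∈ I, deriv μ y ^ 2 = c) :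
    ∃ s y₀ : ℝ, (s = 1 ∨ s = -1) ∧ ∀ y ∈ I, μ y = √c * (s * (y - y₀)) := by
  have hr : 0 < √c := Real.sqrt_pos.2 hc0
  have hμ' : ContinuousOn (deriv μ) I :=
    (hμ.deriv_of_isOpen hI (m := ∞) (by simp)).continuousOn
  -- Being continuous and never zero, μ' has constant sign on the connected set I.
  have hs : ∃ s : ℝ, (s = 1 ∨ s = -1) ∧ ∀ y ∈ I, deriv μ y = √c * s := by
    rcases hc.isPreconnected.eq_or_eq_neg_of_sq_eq hμ' (g := fun _ => √c) continuousOn_const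
      (fun y hy => by simp [H y hy, Real.sq_sqrt hc0.le]) (fun _ => hr.ne') with h | h
    · exact ⟨1, Or.inl rfl, fun y hy => by rw [h hy, mul_one]⟩
    · exact ⟨-1, Or.inr rfl, fun y hy => by rw [h hy]; simp⟩
  obtain ⟨s, hs, hd⟩ := hs
  have hs2 : s * s = 1 := by rcases hs with rfl | rfl <;> norm_num
  obtain ⟨y₁, hy₁⟩ := hc.nonempty
  have hdμ : ∀ y ∈ I, HasDerivAt μ (√c * s) y := fun y hy => by
    rw [← hd y hy]
    exact ((hμ.contDiffAt (hI.mem_nhds hy)).differentiableAt (by simp)).hasDerivAt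
  have hdf : ∀ y ∈ I, HasDerivAt (fun y => μ y - √c * s * y) 0 y := fun y hy => by
    simpa using (hdμ y hy).fun_sub ((hasDerivAt_id y).const_mul (√c * s))
  -- This is the zero of the affine function through (y₁, μ y₁) with slope s√c, as 1/s = s.
  refine ⟨s, y₁ - s * μ y₁ / √c, hs, fun y hy => ?_⟩
  have := hI.is_const_of_deriv_eq_zero hc.isPreconnected
    (fun z hz => (hdf z hz).differentiableAt.differentiableWithinAt)
    (fun z hz => (hdf z hz).deriv) hy hy₁
  have e : √c * (s * (y - (y₁ - s * μ y₁ / √c))) = √c * s * (y - y₁) + s * s * μ y₁ := by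
    field_simp
    ring
  rw [e, hs2]
  linear_combination this

/-- Used where ∂ᵢV ≠ 0: an identity between a e^{cV} and something independent of x then needs a c =
0. -/
theorem pderiv_exp_eq_zero {ι : Type*} [Fintype ι] [DecidableEq ι] {D : Set (ι → ℝ)}
    {f : (ι → ℝ) → ℝ} (hD : IsOpen D) (hf : ContDiffOn ℝ ∞ f D) {a b c : ℝ}
    (H : ∀ x ∈ D, a * Real.exp (c * f x) = b) {x : ι → ℝ} (hx : x ∈ D) (i : ι) :
    a * c * pderiv i f x = 0 := by
  have h1 := pderiv_congr hD hx H i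
  have hd := hf.diffAt hD hx
  rw [pderiv_const_mul, pderiv_exp (hd.const_mul c), pderiv_const_mul, pderiv_const] at h1
  have := Real.exp_ne_zero (c * f x)
  have h2 : Real.exp (c * f x) * (a * c * pderiv i f x) = 0 := by rw [← h1]; ring
  exact (mul_eq_zero.1 h2).resolve_left this

/-- A transformation template that solves the field equations with vanishing potential has the
parameters of the family. -/
theorem IsClassTLambda.existsUnique_familyMember (hn : 3 ≤ n) (hκ : 0 < κ) (hε : ε * ε = 1)
    (hβ : T.β n = 0) (H : IsClassTLambda ε κ (fun _ => 0) Λ Ω V h I T) :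
    ∃! χ : ℝ, IsFamilyMember n ε κ Λ I T χ := by
  have hs := H.seed
  have hn' : (3 : ℝ) ≤ n := by exact_mod_cast hn
  have h1 : (0 : ℝ) < n - 1 := by linarith
  have h0 : (0 : ℝ) < n := by linarith
  have e1 : ((n + 1 : ℕ) : ℝ) - 1 = n := by push_cast; ring
  have e2 : ((n + 1 : ℕ) : ℝ) - 2 = n - 1 := by push_cast; ring
  have hε0 : ε ≠ 0 := left_ne_zero_of_mul_eq_one hε
  have hK : einsteinConst n Λ ≠ 0 := by
    rw [einsteinConst, e2]
    exact mul_ne_zero (div_ne_zero two_ne_zero h1.ne') H.cosm_ne_zero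
  have hΛ : Λ = einsteinConst n Λ * (n - 1) / 2 := by
    rw [einsteinConst, e2]; field_simp
  set K := einsteinConst n Λ with hKdef
  have eqs := (T.solution_iff hs H.isOpen H.smooth hε).1 H.solution
  have hq := hs.regular.quotient hs.smooth_potential
  obtain ⟨x₁, hx₁, i₁, hi₁⟩ := hs.exists_pderiv_ne_zero hε hn H.cosm_ne_zero
  obtain ⟨y₁, hy₁, hμ₁⟩ : ∃ y ∈ I, deriv T.μ y ≠ 0 := by
    by_contra! hc
    obtain ⟨a, ha, b, hb, hab⟩ := H.not_const
    exact hab (H.isOpen.is_const_of_deriv_eq_zero H.connected.isPreconnected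
      (H.smooth.differentiableOn (by simp)) hc ha hb)
  have hexp : ∀ x, (Real.exp (2 * (T.τ * V x)))⁻¹ * Real.exp (2 * V x)
      = Real.exp ((2 * (1 - T.τ)) * V x) := by
    intro x
    rw [← Real.exp_neg, ← Real.exp_add]; ring_nf
  -- Without the Hessian term the spatial equation equates a multiple of dV ⊗ dV with a multiple of
  -- q, so the latter vanishes.
  have hbr : ∀ y ∈ I, ∀ x ∈ Ω, ε * (deriv (deriv T.μ) y + (n - 1) * deriv T.μ y ^ 2)
      = (T.τ + T.α) * K * Real.exp ((2 * (1 - T.τ)) * V x) := by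
    intro y hy x hx
    have hk : (⟨0, by omega⟩ : Fin n) ≠ ⟨1, by omega⟩ := by simp
    have := hq.eq_zero_of_rank_one hx hk (v := fun i => pderiv i V x)
      (X := (n - 2) * T.τ ^ 2 + (n - 1) * (T.α ^ 2 + 2 * T.α * T.τ) - (n - 1) - κ * T.σ ^ 2)
      (Y := (T.τ + T.α) * sourceTerm n Λ (T.β n) V h x
            + Real.exp (2 * (T.τ * V x)) * ε
              * (deriv (deriv T.μ) y + (n - 1) * deriv T.μ y ^ 2))
      (fun i j => by
        have := (eqs y hy x hx).2.2.1 i j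
        rw [hβ] at this ⊢
        linear_combination this)
    rw [sourceTerm, hβ] at this
    rw [← hexp]
    have hE := Real.exp_ne_zero (2 * (T.τ * V x))
    apply mul_left_cancel₀ hE
    rw [show Real.exp (2 * (T.τ * V x)) * ((T.τ + T.α) * K *
      ((Real.exp (2 * (T.τ * V x)))⁻¹ * Real.exp (2 * V x)))
      = (T.τ + T.α) * K * Real.exp (2 * V x) by field_simp]
    linear_combination this
  have h00 : ∀ y ∈ I, ∀ x ∈ Ω, ε * T.α * K * Real.exp ((2 * (1 - T.τ)) * V x)
      = κ * (T.ρ ^ 2 * deriv T.μ y ^ 2) + n * deriv (deriv T.μ) y := by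
    intro y hy x hx
    have := (eqs y hy x hx).1
    rw [sourceTerm, hβ] at this
    rw [← hexp]
    linear_combination this
  -- If τ ≠ 1, both exponentials in V are nonconstant, so their coefficients vanish: α = 0 and τ + α
  -- = 0. Then β = -(n-1), a contradiction.
  have hτ : T.τ = 1 := by
    by_contra hne
    have h2 : (2 : ℝ) * (1 - T.τ) ≠ 0 := mul_ne_zero two_ne_zero (sub_ne_zero.2 (Ne.symm hne))
    have ha := pderiv_exp_eq_zero hs.isOpen hs.smooth_potential (fun x hx => h00 y₁ hy₁ x hx)
      hx₁ i₁
    have hb := pderiv_exp_eq_zero hs.isOpen hs.smooth_potential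
      (fun x hx => (hbr y₁ hy₁ x hx).symm) hx₁ i₁
    have hα : T.α = 0 := by simpa [hε0, hK, h2, hi₁] using ha
    have hτα : T.τ + T.α = 0 := by simpa only [mul_eq_zero, hK, h2, hi₁, or_false] using hb
    have hτ0 : T.τ = 0 := by linarith
    rw [Template.β, hα, hτ0] at hβ
    linarith
  have hα : (n - 1) * T.α = 1 := by
    have := hβ
    rw [Template.β, hτ] at this
    linarith
  have hα' : T.α = 1 / ((n : ℝ) - 1) := by rw [eq_div_iff h1.ne']; linarith
  have hσρ : κ * (T.σ * T.ρ) = 1 := by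
    have := (eqs y₁ hy₁ x₁ hx₁).2.1 i₁
    rw [hα] at this
    have hne := mul_ne_zero hμ₁ hi₁
    apply mul_right_cancel₀ hne
    linarith
  simp only [hτ, sub_self, mul_zero, zero_mul, Real.exp_zero, mul_one] at hbr h00
  have hσ : κ * T.σ ^ 2 = n / (n - 1) := by
    have := (eqs y₁ hy₁ x₁ hx₁).2.2.1 i₁ i₁
    have hb := hbr y₁ hy₁ x₁ hx₁
    rw [sourceTerm, hβ, hτ] at this
    have hne := mul_ne_zero hi₁ hi₁
    -- The multiple of q is already known to vanish; what remains is the coefficient of (∂ᵢV)² at a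
    -- point where ∂ᵢV ≠ 0.
    have h3 : κ * T.σ ^ 2 = (n - 2) + (n - 1) * (T.α ^ 2 + 2 * T.α) - (n - 1) := by
      apply mul_right_cancel₀ hne
      simp only [one_mul] at this
      linear_combination -this - quotientMetric V h x₁ i₁ i₁ * Real.exp (2 * V x₁) * hb
    rw [h3, hα']
    field_simp
    ring
  have hσ0 : T.σ ≠ 0 := by
    rintro h'
    rw [h', zero_mul, mul_zero] at hσρ
    exact zero_ne_one hσρ
  have hρ : κ * T.ρ ^ 2 = (n - 1) / n := by
    rw [eq_div_iff h0.ne']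
    have hx : κ * T.σ ^ 2 * (n - 1) = n := by rw [hσ]; field_simp
    linear_combination (-κ * T.ρ ^ 2) * hx + (n - 1) * (κ * (T.σ * T.ρ) + 1) * hσρ
  -- The yy equation and the trace relation are linear in μ'' and μ'². Eliminating μ'' leaves μ'²
  -- with a coefficient proportional to n² - 1 ≠ 0.
  have hμsq : ∀ y ∈ I, deriv T.μ y ^ 2 = ε * K * n / (n - 1) ^ 2 := by
    intro y hy
    have ha := h00 y hy x₁ hx₁
    have hb := hbr y hy x₁ hx₁
    rw [← mul_assoc, hρ, hα'] at ha
    rw [hα'] at hb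
    have hb' : deriv (deriv T.μ) y + (n - 1) * deriv T.μ y ^ 2 = ε * ((1 + 1 / (n - 1)) * K) := by
      rw [← hb]; linear_combination (-(deriv (deriv T.μ) y + (n - 1) * deriv T.μ y ^ 2)) * hε
    have hd : deriv (deriv T.μ) y
        = ε * ((1 + 1 / (n - 1)) * K) - (n - 1) * deriv T.μ y ^ 2 := by linarith
    rw [hd] at ha
    field_simp at ha ⊢
    have h2 : ((n : ℝ) ^ 2 - 1) ≠ 0 := by nlinarith
    apply mul_left_cancel₀ h2
    linear_combination ha
  set c := ε * K * n / (n - 1) ^ 2 with hcdef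
  -- Positivity of c, hence the sign condition tying Λ to ε, comes from a point where μ' ≠ 0.
  have hc0 : 0 < c := by
    rw [← hμsq y₁ hy₁]; positivity
  obtain ⟨s, y₀, hsgn, hμ⟩ := affine_of_deriv_sq H.isOpen H.connected H.smooth hc0 hμsq
  have hσsq : √((n : ℝ) / (κ * (n - 1))) = |T.σ| := by
    rw [← Real.sqrt_sq_eq_abs]
    congr 1
    rw [div_eq_iff (by positivity)]
    have hx : κ * T.σ ^ 2 * (n - 1) = n := by rw [hσ]; field_simp
    linarith
  obtain ⟨e, he, hσe⟩ : ∃ e : ℝ, (e = 1 ∨ e = -1) ∧ T.σ = e * √(n / (κ * (n - 1))) := by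
    rw [hσsq]
    rcases le_or_gt 0 T.σ with h' | h'
    · exact ⟨1, Or.inl rfl, by rw [abs_of_nonneg h', one_mul]⟩
    · exact ⟨-1, Or.inr rfl, by rw [abs_of_neg h']; ring⟩
  have he2 : e * e = 1 := by rcases he with rfl | rfl <;> norm_num
  have hT : IsFamilyTemplate n κ e T := by
    refine ⟨hα', ?_, hσe, ?_⟩
    · have := hτ
      rw [Template.τ, hα'] at this
      have hδ : T.δ = 1 - 2 * (1 / ((n : ℝ) - 1)) := by linarith
      have h2 : (n : ℝ) - 2 ≠ 0 := by linarith
      rw [hδ]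
      field_simp
      ring
    · have hm := sqrt_family_mul hn hκ
      have hx : κ * T.σ ≠ 0 := mul_ne_zero hκ.ne' hσ0
      apply mul_left_cancel₀ hx
      rw [mul_assoc, hσρ]
      have : κ * T.σ * (e * √((n - 1) / (κ * n)))
          = κ * (e * e) * (√((n : ℝ) / (κ * (n - 1))) * √(((n : ℝ) - 1) / (κ * n))) := by
        rw [hσe]; ring
      rw [this, he2, hm]
      field_simp
  refine ⟨-c, hT.isFamilyMember hn hκ he (neg_lt_zero.2 hc0) ?_ hsgn (y₀ := y₀) ?_, ?_⟩
  · rw [familyCosm, e1, e2, hcdef, hΛ]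
    field_simp
    linear_combination -hε
  · simpa using hμ
  -- Uniqueness needs only that Λ determines χ.
  · intro χ' hχ'
    apply familyCosm_injective hn hε
    rw [← hχ'.2.1, familyCosm, e1, e2, hcdef, hΛ]
    field_simp
    linear_combination -hε

end Converse

/-- Scale each axis to length one and swap the negative direction into position 0. -/
theorem isLorentzian_of_diagonal {n : ℕ} {G : Matrix (Fin (n + 1)) (Fin (n + 1)) ℝ}
    (hG : ∀ a b, a ≠ b → G a b = 0) (a₀ : Fin (n + 1)) (hneg : G a₀ a₀ < 0)
    (hpos : ∀ a, a ≠ a₀ → 0 < G a a) : IsLorentzian G := by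
  set P : Matrix (Fin (n + 1)) (Fin (n + 1)) ℝ :=
    Matrix.of fun c a => if c = Equiv.swap 0 a₀ a then (√|G c c|)⁻¹ else 0 with hP
  have hs : ∀ c, G c c ≠ 0 → (√|G c c|)⁻¹ * G c c * (√|G c c|)⁻¹ = G c c / |G c c| := by
    intro c hc
    have h1 : 0 < |G c c| := abs_pos.2 hc
    have h2 : √|G c c| * √|G c c| = |G c c| := Real.mul_self_sqrt h1.le
    rw [mul_right_comm, ← mul_inv, h2, div_eq_inv_mul]
  have key : Pᵀ * G * P = Matrix.diagonal (fun a => if a = 0 then (-1 : ℝ) else 1) := by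
    ext a b
    have : (Pᵀ * G * P) a b = (√|G (Equiv.swap 0 a₀ a) (Equiv.swap 0 a₀ a)|)⁻¹
        * G (Equiv.swap 0 a₀ a) (Equiv.swap 0 a₀ b)
        * (√|G (Equiv.swap 0 a₀ b) (Equiv.swap 0 a₀ b)|)⁻¹ := by
      simp [Matrix.mul_apply, hP]
    rw [this]
    by_cases hab : a = b
    · subst hab
      rw [Matrix.diagonal_apply_eq]
      by_cases ha : a = 0
      · subst ha
        rw [Equiv.swap_apply_left, hs _ hneg.ne, abs_of_neg hneg, if_pos rfl, div_neg,
          div_self hneg.ne]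
      · have hne : Equiv.swap 0 a₀ a ≠ a₀ := by
          intro h
          apply ha
          rw [← Equiv.swap_apply_left 0 a₀] at h
          exact (Equiv.swap 0 a₀).injective h
        have := hpos _ hne
        rw [hs _ this.ne', abs_of_pos this, div_self this.ne', if_neg ha]
    · rw [Matrix.diagonal_apply_ne _ hab, hG _ _ fun h => hab ((Equiv.swap 0 a₀).injective h)]
      simp
  refine ⟨P, ?_, key⟩
  rw [isUnit_iff_ne_zero]
  intro h0
  have := congrArg Matrix.det key
  rw [Matrix.det_mul, h0, mul_zero, Matrix.det_diagonal] at this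
  exact Finset.prod_ne_zero_iff.2 (fun a _ => by split_ifs <;> norm_num) this.symm

/-! ### A flat base metric with an arbitrary coordinate along one line. -/

section Flat

variable {m : ℕ} (Q : ℝ → ℝ) (η : Fin m → ℝ)

/-- The flat metric `Q(z) dz² + ∑ ηᵢ (dxⁱ)²`, where `z` is the first coordinate. -/
def lineMetric (x : Fin (m + 1) → ℝ) : Matrix (Fin (m + 1)) (Fin (m + 1)) ℝ :=
  blockForm (Q (x 0)) (Matrix.diagonal η)

variable {Q η} {J : Set ℝ} {Ω : Set (Fin (m + 1) → ℝ)} (hJ : IsOpen J) (hΩ : IsOpen Ω)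
  (hΩJ : ∀ x ∈ Ω, x 0 ∈ J) (hQ : ContDiffOn ℝ ∞ Q J) (hQ0 : ∀ z ∈ J, Q z ≠ 0)
  (hη : ∀ i, η i ≠ 0)

theorem contDiffOn_comp_zero {f : ℝ → ℝ} (hΩJ : ∀ x ∈ Ω, x 0 ∈ J) (hf : ContDiffOn ℝ ∞ f J) :
    ContDiffOn ℝ ∞ (fun x : Fin (m + 1) → ℝ => f (x 0)) Ω :=
  hf.comp (contDiff_apply ℝ ℝ (0 : Fin (m + 1))).contDiffOn hΩJ

theorem isUnit_det_diagonal (hη : ∀ i, η i ≠ 0) : IsUnit (Matrix.diagonal η).det := by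
  rw [Matrix.det_diagonal, isUnit_iff_ne_zero]
  exact Finset.prod_ne_zero_iff.2 fun i _ => hη i

include hΩJ hQ hQ0 hη

theorem regularOn_lineMetric : RegularOn Ω (lineMetric Q η) where
  smooth i j := by
    refine Fin.cases ?_ (fun i => ?_) i <;> refine Fin.cases ?_ (fun j => ?_) j
    · exact contDiffOn_comp_zero hΩJ hQ
    · exact contDiffOn_const
    · exact contDiffOn_const
    · exact contDiffOn_const
  symm x _ i j := by
    have : (lineMetric Q η x)ᵀ = lineMetric Q η x := by
      rw [lineMetric, blockForm_transpose, Matrix.diagonal_transpose]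
    exact congrFun (congrFun this j) i
  nondeg x hx := isUnit_det_blockForm (hQ0 _ (hΩJ x hx)) (isUnit_det_diagonal hη)

include hJ in
theorem christoffel_lineMetric {x : Fin (m + 1) → ℝ} (hx : x ∈ Ω) (k i j : Fin (m + 1)) :
    christoffel (lineMetric Q η) k i j x
      = if k = 0 ∧ i = 0 ∧ j = 0 then deriv Q (x 0) / (2 * Q (x 0)) else 0 := by
  have h0 := hQ0 _ (hΩJ x hx)
  have hd : DifferentiableAt ℝ Q (x 0) :=
    (hQ.contDiffAt (hJ.mem_nhds (hΩJ x hx))).differentiableAt (by simp)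
  have hinv : (lineMetric Q η x)⁻¹ = blockForm (Q (x 0))⁻¹ (Matrix.diagonal η)⁻¹ :=
    blockForm_inv h0 (isUnit_det_diagonal hη)
  rw [christoffel, hinv, Fin.sum_univ_succ]
  refine Fin.cases ?_ (fun k => ?_) k <;> refine Fin.cases ?_ (fun i => ?_) i <;>
    refine Fin.cases ?_ (fun j => ?_) j <;>
    simp [lineMetric, pderiv_const, pderiv_comp_coord (0 : Fin (m + 1)) hd]
  field_simp

include hJ hΩ

/-- Reparametrizing z makes the coefficients constant. In the given coordinates the only nonzero
symbol is Γᶻ_zz, a function of z alone, and its contributions cancel in pairs. -/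
theorem ricci_lineMetric {x : Fin (m + 1) → ℝ} (hx : x ∈ Ω) (i j : Fin (m + 1)) :
    ricci (lineMetric Q η) x i j = 0 := by
  have hΓ := fun {x} hx => christoffel_lineMetric (x := x) hJ hΩJ hQ hQ0 hη hx
  have hd : ∀ a k i j, ¬(k = 0 ∧ i = 0 ∧ j = 0) →
      pderiv a (christoffel (lineMetric Q η) k i j) x = 0 := by
    intro a k i j hk
    rw [pderiv_congr hΩ hx (fun z hz => (hΓ hz k i j).trans (if_neg hk)), pderiv_const]
  have hΓs : ContDiffOn ℝ ∞ (fun z => deriv Q z / (2 * Q z)) J :=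
    (hQ.deriv_of_isOpen hJ (m := ∞) (by simp)).div (contDiffOn_const.mul hQ)
      fun z hz => mul_ne_zero two_ne_zero (hQ0 z hz)
  have hd0 : ∀ a : Fin m, pderiv a.succ (christoffel (lineMetric Q η) 0 0 0) x = 0 := by
    intro a
    rw [pderiv_congr hΩ hx (fun z hz => (hΓ hz 0 0 0).trans (if_pos ⟨rfl, rfl, rfl⟩)),
      pderiv_comp_coord 0 ((hΓs.contDiffAt (hJ.mem_nhds (hΩJ x hx))).differentiableAt (by simp)),
      if_neg (Fin.succ_ne_zero a)]
  rw [ricci]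
  simp only [hΓ hx, Fin.sum_univ_succ]
  refine Fin.cases ?_ (fun i => ?_) i <;> refine Fin.cases ?_ (fun j => ?_) j <;>
    simp [hd, hd0]

section Functions

variable {f g : ℝ → ℝ} (hf : ContDiffOn ℝ ∞ f J) (hg : ContDiffOn ℝ ∞ g J)
  {x : Fin (m + 1) → ℝ} (hx : x ∈ Ω)

include hf hx

omit hΩ hQ hQ0 hη in
theorem pderiv_comp_zero (i : Fin (m + 1)) :
    pderiv i (fun x : Fin (m + 1) → ℝ => f (x 0)) x = if i = 0 then deriv f (x 0) else 0 :=
  pderiv_comp_coord 0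
    ((hf.contDiffAt (hJ.mem_nhds (hΩJ x hx))).differentiableAt (by simp)) i

theorem hess_lineMetric (i j : Fin (m + 1)) :
    hess (lineMetric Q η) (fun x => f (x 0)) x i j = if i = 0 ∧ j = 0 then
      deriv (deriv f) (x 0) - deriv Q (x 0) / (2 * Q (x 0)) * deriv f (x 0) else 0 := by
  have hf' : ContDiffOn ℝ ∞ (deriv f) J := hf.deriv_of_isOpen hJ (m := ∞) (by simp)
  have h2 : pderiv i (pderiv j fun x : Fin (m + 1) → ℝ => f (x 0)) x
      = if i = 0 ∧ j = 0 then deriv (deriv f) (x 0) else 0 := by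
    rw [pderiv_congr hΩ hx (fun z hz => pderiv_comp_zero hJ hΩJ hf hz j)]
    by_cases hj : j = 0
    · simp only [hj, if_true, and_true]
      exact pderiv_comp_zero hJ hΩJ hf' hx i
    · simp [hj, pderiv_const]
  rw [hess, h2]
  simp only [christoffel_lineMetric hJ hΩJ hQ hQ0 hη hx, pderiv_comp_zero hJ hΩJ hf hx]
  by_cases hij : i = 0 ∧ j = 0
  · simp [hij]
  · simp [hij]

theorem box_lineMetric :
    box (lineMetric Q η) (fun x => f (x 0)) x
      = (Q (x 0))⁻¹ * (deriv (deriv f) (x 0) - deriv Q (x 0) / (2 * Q (x 0)) * deriv f (x 0)) := by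
  have hinv : (lineMetric Q η x)⁻¹ = blockForm (Q (x 0))⁻¹ (Matrix.diagonal η)⁻¹ :=
    blockForm_inv (hQ0 _ (hΩJ x hx)) (isUnit_det_diagonal hη)
  rw [box_eq_sum_hess]
  simp only [hess_lineMetric hJ hΩ hΩJ hQ hQ0 hη hf hx, hinv, Fin.sum_univ_succ]
  simp

include hg in
theorem gradInner_lineMetric :
    gradInner (lineMetric Q η) (fun x => f (x 0)) (fun x => g (x 0)) x
      = (Q (x 0))⁻¹ * (deriv f (x 0) * deriv g (x 0)) := by
  have hinv : (lineMetric Q η x)⁻¹ = blockForm (Q (x 0))⁻¹ (Matrix.diagonal η)⁻¹ :=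
    blockForm_inv (hQ0 _ (hΩJ x hx)) (isUnit_det_diagonal hη)
  simp only [gradInner, grad, pderiv_comp_zero hJ hΩJ hf hx, pderiv_comp_zero hJ hΩJ hg hx, hinv,
    Fin.sum_univ_succ]
  simp
  ring

end Functions
end Flat

/-! ### Static planar seeds as conformal rescalings of the flat base. -/

section StaticSeed

variable {m : ℕ}

/-- The quotient form `h` of the seed with potential `v(z)` and lapse `F(z)`, whose metric is
`ε e^{2v} dy² + e^{2z} (dz² / F + ∑ ηᵢ (dxⁱ)²)`. -/
def lineQuotient (F v : ℝ → ℝ) (η : Fin m → ℝ) :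
    (Fin (m + 1) → ℝ) → Matrix (Fin (m + 1)) (Fin (m + 1)) ℝ :=
  conformal (fun x => x 0 + v (x 0)) (lineMetric (fun z => (F z)⁻¹) η)

theorem quotientMetric_lineQuotient (F v : ℝ → ℝ) (η : Fin m → ℝ) :
    quotientMetric (fun x => v (x 0)) (lineQuotient F v η)
      = conformal (fun x => x 0 - v (x 0)) (lineMetric (fun z => (F z)⁻¹) η) := by
  funext x
  simp only [quotientMetric, lineQuotient, conformal, smul_smul, ← Real.exp_add]
  ring_nf

variable {F v : ℝ → ℝ} {η : Fin m → ℝ} {J : Set ℝ} {Ω : Set (Fin (m + 1) → ℝ)}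
  (hJ : IsOpen J) (hΩ : IsOpen Ω) (hΩJ : ∀ x ∈ Ω, x 0 ∈ J) (hF : ContDiffOn ℝ ∞ F J)
  (hv : ContDiffOn ℝ ∞ v J) (hF0 : ∀ z ∈ J, F z ≠ 0) (hη : ∀ i, η i ≠ 0)
  (hdv : ∀ z ∈ J, deriv v z = deriv F z / (2 * F z))
include hJ hF hF0

/-- This is Γᶻ_zz of the base for Q = 1/F. When v' = F'/(2F), that is, when e^{2v} is a constant
multiple of F, it equals -v', and the curvature can be expressed through F, v' and v''. -/
theorem deriv_inv_div {z : ℝ} (hz : z ∈ J) :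
    deriv (fun z => (F z)⁻¹) z / (2 * (F z)⁻¹) = -(deriv F z / (2 * F z)) := by
  have hd : DifferentiableAt ℝ F z :=
    (hF.contDiffAt (hJ.mem_nhds hz)).differentiableAt (by simp)
  have := hF0 z hz
  rw [(hd.hasDerivAt.fun_inv this).deriv]
  field_simp

include hdv in
theorem deriv_deriv_potential {z : ℝ} (hz : z ∈ J) :
    deriv (deriv v) z = deriv (deriv F) z / (2 * F z) - 2 * deriv v z ^ 2 := by
  have hd : DifferentiableAt ℝ F z :=
    (hF.contDiffAt (hJ.mem_nhds hz)).differentiableAt (by simp)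
  have hd' : DifferentiableAt ℝ (deriv F) z :=
    ((hF.deriv_of_isOpen hJ (m := ∞) (by simp)).contDiffAt (hJ.mem_nhds hz)).differentiableAt
      (by simp)
  have h0 := hF0 z hz
  have he : deriv v =ᶠ[nhds z] fun z => deriv F z / (2 * F z) :=
    Filter.eventually_of_mem (hJ.mem_nhds hz) hdv
  rw [he.deriv_eq, (hd'.hasDerivAt.fun_div (hd.hasDerivAt.const_mul 2) (by simpa using h0)).deriv,
    hdv z hz]
  field_simp

theorem deriv_id_sub_potential (hv : ContDiffOn ℝ ∞ v J) {z : ℝ} (hz : z ∈ J) :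
    deriv (fun z => z - v z) z = 1 - deriv v z := by
  have hd : DifferentiableAt ℝ v z :=
    (hv.contDiffAt (hJ.mem_nhds hz)).differentiableAt (by simp)
  exact ((hasDerivAt_id z).sub hd.hasDerivAt).deriv

theorem deriv_deriv_id_sub_potential (hv : ContDiffOn ℝ ∞ v J) {z : ℝ} (hz : z ∈ J) :
    deriv (deriv fun z => z - v z) z = -deriv (deriv v) z := by
  have he : deriv (fun z => z - v z) =ᶠ[nhds z] fun z => 1 - deriv v z :=
    Filter.eventually_of_mem (hJ.mem_nhds hz) fun z hz => deriv_id_sub_potential hJ hF hF0 hv hz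
  have hd : DifferentiableAt ℝ (deriv v) z :=
    ((hv.deriv_of_isOpen hJ (m := ∞) (by simp)).contDiffAt (hJ.mem_nhds hz)).differentiableAt
      (by simp)
  rw [he.deriv_eq, (hd.hasDerivAt.const_sub 1).deriv]

include hΩ hΩJ hv hη

theorem regularOn_lineQuotient : RegularOn Ω (lineQuotient F v η) :=
  (regularOn_lineMetric hΩJ (hF.inv hF0) (fun z hz => inv_ne_zero (hF0 z hz)) hη).conformal_metric
    (contDiffOn_comp_zero hΩJ (contDiffOn_id.add hv))

include hdv

/-- Hessian, gradient and d'Alembertian of the potential with respect to the quotient metric. -/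
theorem hess_lineQuotient {x : Fin (m + 1) → ℝ} (hx : x ∈ Ω) (i j : Fin (m + 1)) :
    hess (quotientMetric (fun x => v (x 0)) (lineQuotient F v η)) (fun x => v (x 0)) x i j
      = (if i = 0 ∧ j = 0 then deriv (deriv v) (x 0) + 3 * deriv v (x 0) ^ 2
          - 2 * deriv v (x 0) else 0)
        + lineMetric (fun z => (F z)⁻¹) η x i j
          * (F (x 0) * (deriv v (x 0) * (1 - deriv v (x 0)))) := by
  have hQ : ContDiffOn ℝ ∞ (fun z => (F z)⁻¹) J := hF.inv hF0
  have hQ0 : ∀ z ∈ J, (F z)⁻¹ ≠ 0 := fun z hz => inv_ne_zero (hF0 z hz)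
  have hb := regularOn_lineMetric hΩJ hQ hQ0 hη
  have hθ : ContDiffOn ℝ ∞ (fun z => z - v z) J := contDiffOn_id.sub hv
  have hz := hΩJ x hx
  rw [quotientMetric_lineQuotient, hb.hess_conformal hΩ (contDiffOn_comp_zero hΩJ hθ) hx,
    hess_lineMetric hJ hΩ hΩJ hQ hQ0 hη hv hx, gradInner_lineMetric hJ hΩ hΩJ hQ hQ0 hη hv hθ hx]
  simp only [pderiv_comp_zero hJ hΩJ hv hx, pderiv_comp_zero hJ hΩJ hθ hx,
    deriv_id_sub_potential hJ hF hF0 hv hz, deriv_inv_div hJ hF hF0 hz, ← hdv _ hz, inv_inv]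
  by_cases hi : i = 0 <;> by_cases hj : j = 0 <;> simp [hi, hj]
  ring

theorem gradInner_lineQuotient {x : Fin (m + 1) → ℝ} (hx : x ∈ Ω) :
    gradInner (quotientMetric (fun x => v (x 0)) (lineQuotient F v η)) (fun x => v (x 0))
      (fun x => v (x 0)) x
      = (Real.exp (2 * (x 0 - v (x 0))))⁻¹ * (F (x 0) * deriv v (x 0) ^ 2) := by
  have hQ : ContDiffOn ℝ ∞ (fun z => (F z)⁻¹) J := hF.inv hF0
  have hQ0 : ∀ z ∈ J, (F z)⁻¹ ≠ 0 := fun z hz => inv_ne_zero (hF0 z hz)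
  have hb := regularOn_lineMetric hΩJ hQ hQ0 hη
  rw [quotientMetric_lineQuotient, hb.gradInner_conformal hx,
    gradInner_lineMetric hJ hΩ hΩJ hQ hQ0 hη hv hv hx, inv_inv, sq]

theorem box_lineQuotient {x : Fin (m + 1) → ℝ} (hx : x ∈ Ω) :
    box (quotientMetric (fun x => v (x 0)) (lineQuotient F v η)) (fun x => v (x 0)) x
      = (Real.exp (2 * (x 0 - v (x 0))))⁻¹ * (F (x 0) * (deriv (deriv v) (x 0)
        + deriv v (x 0) ^ 2 + (m - 1) * (deriv v (x 0) * (1 - deriv v (x 0))))) := by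
  have hQ : ContDiffOn ℝ ∞ (fun z => (F z)⁻¹) J := hF.inv hF0
  have hQ0 : ∀ z ∈ J, (F z)⁻¹ ≠ 0 := fun z hz => inv_ne_zero (hF0 z hz)
  have hb := regularOn_lineMetric hΩJ hQ hQ0 hη
  have hθ : ContDiffOn ℝ ∞ (fun z => z - v z) J := contDiffOn_id.sub hv
  have hz := hΩJ x hx
  rw [quotientMetric_lineQuotient, hb.box_conformal hΩ (contDiffOn_comp_zero hΩJ hθ) hx,
    box_lineMetric hJ hΩ hΩJ hQ hQ0 hη hv hx, gradInner_lineMetric hJ hΩ hΩJ hQ hQ0 hη hv hθ hx,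
    deriv_id_sub_potential hJ hF hF0 hv hz, deriv_inv_div hJ hF hF0 hz, ← hdv _ hz, inv_inv]
  simp only [Fintype.card_fin]
  push_cast
  ring

theorem ricci_lineQuotient {x : Fin (m + 1) → ℝ} (hx : x ∈ Ω) (i j : Fin (m + 1)) :
    ricci (quotientMetric (fun x => v (x 0)) (lineQuotient F v η)) x i j
      = (m - 1) * (if i = 0 ∧ j = 0 then deriv (deriv v) (x 0) - deriv v (x 0)
            * (1 - deriv v (x 0)) + (1 - deriv v (x 0)) ^ 2 else 0)
        - lineMetric (fun z => (F z)⁻¹) η x i j * (F (x 0) * (-deriv (deriv v) (x 0)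
          + deriv v (x 0) * (1 - deriv v (x 0)) + (m - 1) * (1 - deriv v (x 0)) ^ 2)) := by
  have hQ : ContDiffOn ℝ ∞ (fun z => (F z)⁻¹) J := hF.inv hF0
  have hQ0 : ∀ z ∈ J, (F z)⁻¹ ≠ 0 := fun z hz => inv_ne_zero (hF0 z hz)
  have hb := regularOn_lineMetric hΩJ hQ hQ0 hη
  have hθ : ContDiffOn ℝ ∞ (fun z => z - v z) J := contDiffOn_id.sub hv
  have hz := hΩJ x hx
  rw [quotientMetric_lineQuotient, hb.ricci_conformal hΩ (contDiffOn_comp_zero hΩJ hθ) hx,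
    ricci_lineMetric hJ hΩ hΩJ hQ hQ0 hη hx, hess_lineMetric hJ hΩ hΩJ hQ hQ0 hη hθ hx,
    box_lineMetric hJ hΩ hΩJ hQ hQ0 hη hθ hx, gradInner_lineMetric hJ hΩ hΩJ hQ hQ0 hη hθ hθ hx]
  simp only [pderiv_comp_zero hJ hΩJ hθ hx,
    deriv_id_sub_potential hJ hF hF0 hv hz, deriv_deriv_id_sub_potential hJ hF hF0 hv hz,
    deriv_inv_div hJ hF hF0 hz, ← hdv _ hz, inv_inv, Fintype.card_fin]
  push_cast
  by_cases hi : i = 0 <;> by_cases hj : j = 0 <;>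
    simp only [hi, hj, and_self, and_false, false_and, if_true, if_false] <;> ring

/-- The reduced vacuum equations are linear in F: `hsrc` is the yy equation and `hode` the planar
one, while the zz equation holds identically because v' = F'/(2F). In `hsig` the time direction is y
if ε = -1 and one of the planar directions if ε = 1. -/
theorem isSeed_lineQuotient {ε Λ : ℝ} (hc : IsConnected Ω) (hε : ε * ε = 1)
    (hpos : ∀ z ∈ J, 0 < F z)
    (hsig : ε = -1 ∧ (∀ i, 0 < η i) ∨ ε = 1 ∧ ∃ i₀, η i₀ < 0 ∧ ∀ i, i ≠ i₀ → 0 < η i)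
    (hode : ∀ z ∈ J, deriv (deriv F) z + (m - 3) * deriv F z - 2 * (m - 1) * F z = 0)
    (hsrc : ∀ z ∈ J, deriv (deriv F) z + (m - 1) * deriv F z
      = -2 * einsteinConst (m + 1) Λ * Real.exp (2 * z)) :
    IsSeed ε Λ Ω (fun x => v (x 0)) (lineQuotient F v η) := by
  have hV := contDiffOn_comp_zero (Ω := Ω) hΩJ hv
  have hh := regularOn_lineQuotient hJ hΩ hΩJ hF hv hF0 hη
  have hvac : ∀ p ∈ domain Set.univ Ω, ∀ a b,
      ricci (orthMetric ε (fun x => v (x 0)) (lineQuotient F v η)) p a b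
        = einsteinConst (m + 1) Λ * orthMetric ε (fun x => v (x 0)) (lineQuotient F v η) p a b := by
    rw [vacuum_iff hΩ hV hh hε]
    intro x hx
    have hz := hΩJ x hx
    have hF' := hF0 _ hz
    have e2 := deriv_deriv_potential hJ hF hF0 hdv hz
    have e1 := hdv _ hz
    have o1 := hode _ hz
    have o2 := hsrc _ hz
    have f1 : deriv F (x 0) = 2 * F (x 0) * deriv v (x 0) := by rw [e1]; field_simp
    have f2 : deriv (deriv F) (x 0)
        = 2 * F (x 0) * (deriv (deriv v) (x 0) + 2 * deriv v (x 0) ^ 2) := by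
      rw [e2]; field_simp; ring
    rw [f1, f2] at o1 o2
    have o3 : deriv (deriv v) (x 0) + 2 * deriv v (x 0) ^ 2 + (m - 3) * deriv v (x 0)
        - (m - 1) = 0 := by
      apply mul_left_cancel₀ (mul_ne_zero two_ne_zero hF')
      linear_combination o1
    constructor
    · rw [box_lineQuotient hJ hΩ hΩJ hF hv hF0 hη hdv hx,
        gradInner_lineQuotient hJ hΩ hΩJ hF hv hF0 hη hdv hx]
      have hE : Real.exp (2 * v (x 0))
          = (Real.exp (2 * (x 0 - v (x 0))))⁻¹ * Real.exp (2 * x 0) := by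
        rw [← Real.exp_neg, ← Real.exp_add]; ring_nf
      rw [hE]
      push_cast
      linear_combination (Real.exp (2 * (x 0 - v (x 0))))⁻¹ * o2 / 2
    · intro i j
      rw [ricci_lineQuotient hJ hΩ hΩJ hF hv hF0 hη hdv hx,
        hess_lineQuotient hJ hΩ hΩJ hF hv hF0 hη hdv hx]
      simp only [pderiv_comp_zero hJ hΩJ hv hx]
      push_cast
      refine Fin.cases ?_ (fun i => ?_) i <;> refine Fin.cases ?_ (fun j => ?_) j
      -- The zz component needs no differential equation for F.
      · simp [lineMetric]
        field_simp
        ring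
      · simp [lineMetric]
      · simp [lineMetric]
      · simp [lineMetric]
        linear_combination Matrix.diagonal η i j * F (x 0) * o3
  refine ⟨hΩ, hc, hV, hh.smooth, ⟨⟨?_, ?_⟩, ?_⟩⟩
  · have hε0 : ε ≠ 0 := left_ne_zero_of_mul_eq_one hε
    rw [orthMetric_eq_inflatedMetric]
    exact ((((hh.quotient hV).conformal_metric (contDiffOn_const.mul hV)).product
      hε0).conformal_metric (contDiffOn_sepField hV contDiffOn_const _ _)).smooth
  · intro p hp
    have hz := hΩJ _ hp.2
    have hFp := hpos _ hz
    have hG : orthMetric ε (fun x => v (x 0)) (lineQuotient F v η) p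
        = blockForm (ε * Real.exp (2 * v (Fin.tail p 0)))
          (Real.exp (2 * Fin.tail p 0) •
            blockForm (F (Fin.tail p 0))⁻¹ (Matrix.diagonal η)) := by
      simp only [orthMetric, lineQuotient, conformal, lineMetric, smul_smul, ← Real.exp_add]
      ring_nf
    rw [hG]
    have hE1 := Real.exp_pos (2 * v (Fin.tail p 0))
    have hE2 := Real.exp_pos (2 * Fin.tail p 0)
    have hoff : ∀ a b : Fin (m + 1 + 1), a ≠ b → blockForm (ε * Real.exp (2 * v (Fin.tail p 0)))
        (Real.exp (2 * Fin.tail p 0) • blockForm (F (Fin.tail p 0))⁻¹ (Matrix.diagonal η)) a b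
        = 0 := by
      intro a b
      refine Fin.cases ?_ (fun a => ?_) a <;> refine Fin.cases ?_ (fun b => ?_) b
      · simp
      · simp
      · simp
      refine Fin.cases ?_ (fun a => ?_) a <;> refine Fin.cases ?_ (fun b => ?_) b
      · simp
      · intro _; rw [blockForm_succ_succ]; simp
      · intro _; rw [blockForm_succ_succ]; simp
      · intro h
        have : a ≠ b := fun h' => h (by rw [h'])
        simp [Matrix.diagonal_apply_ne _ this]
    rcases hsig with ⟨rfl, hη'⟩ | ⟨rfl, i₀, hi₀, hη'⟩
    · refine isLorentzian_of_diagonal hoff 0 (by simpa using hE1) fun a => ?_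
      refine Fin.cases ?_ (fun a => ?_) a
      · simp
      refine Fin.cases ?_ (fun a => ?_) a
      · intro _; simp only [blockForm_succ_succ, Matrix.smul_apply, blockForm_zero_zero,
          smul_eq_mul]; positivity
      · intro _
        simpa using mul_pos hE2 (hη' a)
    · refine isLorentzian_of_diagonal hoff i₀.succ.succ
        (by simpa using mul_neg_of_pos_of_neg hE2 hi₀) fun a => ?_
      refine Fin.cases ?_ (fun a => ?_) a
      · intro _; simpa using hE1
      refine Fin.cases ?_ (fun a => ?_) a
      · intro _; simp only [blockForm_succ_succ, Matrix.smul_apply, blockForm_zero_zero,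
          smul_eq_mul]; positivity
      · intro h
        have : a ≠ i₀ := fun h' => h (by rw [h'])
        simpa using mul_pos hE2 (hη' a this)
  · intro p hp a b
    rw [hvac p hp, einsteinConst]; ring

end StaticSeed

/-! ### Planar Schwarzschild–de Sitter seeds and their use as test seeds. -/

section Existence

/-- The lapse `(f + lam) e^{-(m-1)z} - lam e^{2z}` of the planar Schwarzschild–de Sitter seeds. -/
def lapse (m : ℕ) (f lam z : ℝ) : ℝ :=
  (f + lam) * Real.exp (-(m - 1) * z) - lam * Real.exp (2 * z)

theorem hasDerivAt_exp_comb (a b c d z : ℝ) :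
    HasDerivAt (fun z => a * Real.exp (c * z) - b * Real.exp (d * z))
      (a * c * Real.exp (c * z) - b * d * Real.exp (d * z)) z := by
  have h : ∀ c : ℝ, HasDerivAt (fun z => Real.exp (c * z)) (Real.exp (c * z) * c) z := fun c => by
    simpa using ((hasDerivAt_id z).const_mul c).exp
  exact (((h c).const_mul a).fun_sub ((h d).const_mul b)).congr_deriv (by ring)

theorem deriv_lapse (m : ℕ) (f lam : ℝ) : deriv (lapse m f lam) = fun z =>
    (f + lam) * (-(m - 1)) * Real.exp (-(m - 1) * z) - lam * 2 * Real.exp (2 * z) :=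
  funext fun z => (hasDerivAt_exp_comb _ _ _ _ z).deriv

theorem deriv_deriv_lapse (m : ℕ) (f lam : ℝ) : deriv (deriv (lapse m f lam)) = fun z =>
    (f + lam) * (-(m - 1)) * (-(m - 1)) * Real.exp (-(m - 1) * z)
      - lam * 2 * 2 * Real.exp (2 * z) := by
  rw [deriv_lapse]
  exact funext fun z => (hasDerivAt_exp_comb _ _ _ _ z).deriv

theorem contDiff_lapse (m : ℕ) (f lam : ℝ) : ContDiff ℝ ∞ (lapse m f lam) := by
  unfold lapse
  fun_prop

/-- For every `Λ` there are seeds, with prescribed norm of the gradient of the potential at a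
point. -/
theorem exists_isSeed {n : ℕ} (hn : 3 ≤ n) {ε : ℝ} (hε : ε = 1 ∨ ε = -1) (Λ : ℝ) {f : ℝ}
    (hf : 0 < f) :
    ∃ (Ω : Set (Fin n → ℝ)) (V : (Fin n → ℝ) → ℝ)
      (h : (Fin n → ℝ) → Matrix (Fin n) (Fin n) ℝ), IsSeed ε Λ Ω V h ∧
      ∃ x ∈ Ω, ∃ i, V x = 0 ∧ pderiv i V x = 0 ∧ quotientMetric V h x i i ≠ 0 ∧
        ∃ g : ℝ, 2 * g = -(n - 2) * f - einsteinConst n Λ ∧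
          hess (quotientMetric V h) V x i i = quotientMetric V h x i i * (g - g ^ 2 / f) ∧
          gradInner (quotientMetric V h) V V x = g ^ 2 / f := by
  obtain ⟨m, rfl⟩ : ∃ m, n = m + 1 := ⟨n - 1, by omega⟩
  have hm : 2 ≤ m := by omega
  have hm' : (2 : ℝ) ≤ m := by exact_mod_cast hm
  -- The operator F'' + (m-1)F' annihilates e^{-(m-1)z} and multiplies e^{2z} by 2(m+1), so `hsrc`
  -- forces this value and leaves the other coefficient free; it is used to set F(0) = f.
  set lam := einsteinConst (m + 1) Λ / (m + 1) with hlam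
  have hlam' : einsteinConst (m + 1) Λ = lam * (m + 1) := by rw [hlam]; field_simp
  set F := lapse m f lam with hFdef
  have hFs : ContDiff ℝ ∞ F := contDiff_lapse _ _ _
  set J := {z | 0 < F z} with hJdef
  have hJ : IsOpen J := isOpen_lt continuous_const hFs.continuous
  have hF00 : F 0 = f := by simp [hFdef, lapse]
  have h0J : (0 : ℝ) ∈ J := by rw [hJdef, Set.mem_ofPred_eq, hF00]; exact hf
  obtain ⟨r, hr, hball⟩ := Metric.isOpen_iff.1
    (hJ.preimage (continuous_apply (0 : Fin (m + 1)))) (0 : Fin (m + 1) → ℝ) (by simpa using h0J)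
  set Ω := Metric.ball (0 : Fin (m + 1) → ℝ) r with hΩdef
  have hΩ : IsOpen Ω := Metric.isOpen_ball
  have h0Ω : (0 : Fin (m + 1) → ℝ) ∈ Ω := Metric.mem_ball_self hr
  have hΩJ : ∀ x ∈ Ω, x 0 ∈ J := fun x hx => hball hx
  have hΩc : IsConnected Ω :=
    ⟨⟨0, h0Ω⟩, (convex_ball (0 : Fin (m + 1) → ℝ) r).isPreconnected⟩
  have hpos : ∀ z ∈ J, 0 < F z := fun z hz => hz
  have hF0 : ∀ z ∈ J, F z ≠ 0 := fun z hz => (hpos z hz).ne'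
  -- Subtracting log f, a rescaling of y, normalizes the potential to zero at the chosen point.
  set v : ℝ → ℝ := fun z => 1 / 2 * (Real.log (F z) - Real.log f) with hvdef
  have hv : ContDiffOn ℝ ∞ v J :=
    contDiffOn_const.mul ((hFs.contDiffOn.log hF0).sub contDiffOn_const)
  have hdv : ∀ z ∈ J, deriv v z = deriv F z / (2 * F z) := by
    intro z hz
    have hd : DifferentiableAt ℝ F z := hFs.contDiffAt.differentiableAt (by simp)
    have h0 := hF0 z hz
    rw [hvdef, (((hd.hasDerivAt.log h0).sub_const _).const_mul (1 / 2)).deriv]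
    field_simp
  have hv0 : v 0 = 0 := by simp [hvdef, hF00]
  set η : Fin m → ℝ := fun i => if ε = 1 ∧ i = ⟨0, by omega⟩ then -1 else 1 with hηdef
  have hη : ∀ i, η i ≠ 0 := by
    intro i
    simp only [hηdef]
    split_ifs <;> norm_num
  have hsig : ε = -1 ∧ (∀ i, 0 < η i) ∨ ε = 1 ∧ ∃ i₀, η i₀ < 0 ∧ ∀ i, i ≠ i₀ → 0 < η i := by
    rcases hε with rfl | rfl
    · exact Or.inr ⟨rfl, ⟨0, by omega⟩, by simp [hηdef], fun i hi => by simp [hηdef, hi]⟩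
    · refine Or.inl ⟨rfl, fun i => ?_⟩
      have : (-1 : ℝ) ≠ 1 := by norm_num
      simp [hηdef, this]
  have hε1 : ε * ε = 1 := by rcases hε with rfl | rfl <;> norm_num
  have hseed := isSeed_lineQuotient (Λ := Λ) hJ hΩ hΩJ hFs.contDiffOn hv hF0 hη hdv hΩc hε1 hpos
    hsig
    (fun z _ => by rw [deriv_deriv_lapse, deriv_lapse, hFdef, lapse]; ring)
    (fun z _ => by rw [deriv_deriv_lapse, deriv_lapse, hlam']; ring)
  have hq : quotientMetric (fun x => v (x 0)) (lineQuotient F v η) 0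
      = lineMetric (fun z => (F z)⁻¹) η 0 := by
    rw [quotientMetric_lineQuotient]
    simp [conformal, hv0]
  -- The index is a planar direction, along which V is constant. The witness g = f v'(0) is F'(0)/2.
  refine ⟨Ω, fun x => v (x 0), lineQuotient F v η, hseed, 0, h0Ω, Fin.succ ⟨0, by omega⟩, hv0, ?_,
    ?_, f * deriv v 0, ?_, ?_, ?_⟩
  · rw [pderiv_comp_zero hJ hΩJ hv h0Ω, if_neg (Fin.succ_ne_zero _)]
  · rw [hq, lineMetric, blockForm_succ_succ, Matrix.diagonal_apply_eq]
    exact hη _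
  · rw [hdv 0 h0J, hF00, deriv_lapse, hlam']
    push_cast
    simp only [mul_zero, Real.exp_zero]
    field_simp
    ring
  · rw [hess_lineQuotient hJ hΩ hΩJ hFs.contDiffOn hv hF0 hη hdv h0Ω,
      if_neg (fun h => Fin.succ_ne_zero _ h.1), hq]
    simp only [Pi.zero_apply, hF00]
    field_simp
    ring
  · rw [gradInner_lineQuotient hJ hΩ hΩJ hFs.contDiffOn hv hF0 hη hdv h0Ω]
    simp only [Pi.zero_apply, hF00, hv0, sub_zero, mul_zero, Real.exp_zero, inv_one, one_mul]
    field_simp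

end Existence

/-- A template that solves the field equations for every seed has the transformation weight. -/
theorem Template.β_eq_zero_of_forall_seed {n : ℕ} (hn : 3 ≤ n) {ε κ Λ : ℝ}
    (hε : ε = 1 ∨ ε = -1) (hΛ : Λ ≠ 0) {I : Set ℝ} {T : Template}
    (H : ∀ (Ω : Set (Fin n → ℝ)) (V : (Fin n → ℝ) → ℝ)
      (h : (Fin n → ℝ) → Matrix (Fin n) (Fin n) ℝ), IsSeed ε Λ Ω V h →
      IsClassTLambda ε κ (fun _ => 0) Λ Ω V h I T) : T.β n = 0 := by
  have hn' : (3 : ℝ) ≤ n := by exact_mod_cast hn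
  have hε1 : ε * ε = 1 := by rcases hε with rfl | rfl <;> norm_num
  -- The properties of I are part of the conclusion for each seed, so a seed must exist before they
  -- can be used.
  obtain ⟨y, hy⟩ : I.Nonempty := by
    obtain ⟨Ω, V, h, hs, -⟩ := exists_isSeed hn hε Λ one_pos
    exact (H Ω V h hs).connected.nonempty
  have hK : einsteinConst n Λ ≠ 0 := by
    have e2 : ((n + 1 : ℕ) : ℝ) - 2 = n - 1 := by push_cast; ring
    rw [einsteinConst, e2]
    exact mul_ne_zero (div_ne_zero two_ne_zero (by linarith)) hΛ
  set K := einsteinConst n Λ with hKdef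
  set E := ε * (deriv (deriv T.μ) y + (n - 1) * deriv T.μ y ^ 2) with hE
  -- The spatial equation in a planar direction, cleared of denominators. T and y are fixed, so it
  -- is quadratic in f with fixed coefficients.
  have key : ∀ f : ℝ, 0 < f →
      4 * T.β n * (((-(n - 2) * f - K) / 2) * f - ((-(n - 2) * f - K) / 2) ^ 2)
        + 4 * (T.τ + T.α) * (T.β n * ((-(n - 2) * f - K) / 2) ^ 2 - K * f) + 4 * E * f = 0 := by
    intro f hf
    obtain ⟨Ω, V, h, hs, x, hx, i, hV, hVi, hq, g, hg, hH, hw⟩ := exists_isSeed hn hε Λ hf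
    have hc := H Ω V h hs
    have eq := ((T.solution_iff hs hc.isOpen hc.smooth hε1).1 hc.solution y hy x hx).2.2.1 i i
    rw [sourceTerm, hV, hVi, hH, hw] at eq
    simp only [mul_zero, Real.exp_zero, mul_one, one_mul, add_zero] at eq
    have hg' : (-(n - 2) * f - K) / 2 = g := by rw [← hg]; ring
    rw [hg']
    have h2 : T.β n * (g - g ^ 2 / f) + ((T.τ + T.α) * (T.β n * (g ^ 2 / f) - K) + E) = 0 := by
      apply mul_left_cancel₀ hq
      rw [hE]
      linear_combination -eq
    field_simp at h2
    linear_combination 4 * h2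
  have k1 := key 1 one_pos
  have k2 := key 2 two_pos
  have k3 := key 3 three_pos
  -- Extrapolation to f = 0: a quadratic p satisfies p(0) = 3p(1) - 3p(2) + p(3), and here p(0) =
  -- β(τ + α - 1)K².
  have hbβ : T.β n * (T.τ + T.α - 1) = 0 := by
    have : T.β n * (T.τ + T.α - 1) * K ^ 2 = 0 := by linear_combination 3 * k1 - 3 * k2 + k3
    exact (mul_eq_zero.1 this).resolve_right (pow_ne_zero _ hK)
  -- The second difference isolates the coefficient of f², which is -2β(n-2) + (n-2)²β(τ + α - 1).
  have h2 : T.β n * (n - 2) = 0 := by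
    linear_combination (-1 / 4) * k1 + (1 / 2) * k2 - (1 / 4) * k3
      + ((n : ℝ) - 2) ^ 2 / 2 * hbβ
  exact (mul_eq_zero.1 h2).resolve_right (by linarith)

end EinsteinScalar

end

/-! ### The classification. -/

open EinsteinScalar in
theorem corollary5 (n : ℕ) (hn : 4 ≤ n + 1) (κ ε : ℝ) (hκ : 0 < κ) (hε : ε = 1 ∨ ε = -1) :
    -- every `χ < 0` occurs, and every seed with the right `Λ` gives a solution of the class
    (∀ χ : ℝ, χ < 0 →
      (∃ (Ω : Set (Fin n → ℝ)) (V : (Fin n → ℝ) → ℝ)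
          (h : (Fin n → ℝ) → Matrix (Fin n) (Fin n) ℝ),
        EinsteinScalar.IsSeed ε (EinsteinScalar.familyCosm (n + 1) ε χ) Ω V h) ∧
      ∀ (Ω : Set (Fin n → ℝ)) (V : (Fin n → ℝ) → ℝ)
          (h : (Fin n → ℝ) → Matrix (Fin n) (Fin n) ℝ) (I : Set ℝ) (e : ℝ),
        EinsteinScalar.IsSeed ε (EinsteinScalar.familyCosm (n + 1) ε χ) Ω V h →
        IsOpen I → IsConnected I → (e = 1 ∨ e = -1) →
        EinsteinScalar.IsEinsteinScalarSolution κ (fun _ => 0) (EinsteinScalar.domain I Ω)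
          (EinsteinScalar.familyMetric ε χ V h) (EinsteinScalar.familyField κ e χ V) ∧
        ∃ (T : EinsteinScalar.Template) (lam : ℝ),
          EinsteinScalar.HasFamilyParameters (n + 1) κ e lam T ∧
          EinsteinScalar.IsClassTLambda ε κ (fun _ => 0)
            (EinsteinScalar.familyCosm (n + 1) ε χ) Ω V h I T ∧
          T.metric ε V h = EinsteinScalar.familyMetric ε χ V h ∧
          T.field V = EinsteinScalar.familyField κ e χ V) ∧
    -- every solution of the class that the transformation derives from some seed is a member
    (∀ (Λ : ℝ) (Ω : Set (Fin n → ℝ)) (V : (Fin n → ℝ) → ℝ)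
        (h : (Fin n → ℝ) → Matrix (Fin n) (Fin n) ℝ) (I : Set ℝ)
        (T : EinsteinScalar.Template),
      T.IsTransformation (n + 1) →
      EinsteinScalar.IsClassTLambda ε κ (fun _ => 0) Λ Ω V h I T →
      ∃! χ : ℝ, EinsteinScalar.IsFamilyMember n ε κ Λ I T χ) ∧
    -- so is every template, with arbitrary `δ`, that works for all seeds with a given `Λ ≠ 0`
    (∀ (Λ : ℝ) (I : Set ℝ) (T : EinsteinScalar.Template), Λ ≠ 0 →
      (∀ (Ω : Set (Fin n → ℝ)) (V : (Fin n → ℝ) → ℝ)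
          (h : (Fin n → ℝ) → Matrix (Fin n) (Fin n) ℝ),
        EinsteinScalar.IsSeed ε Λ Ω V h →
        EinsteinScalar.IsClassTLambda ε κ (fun _ => 0) Λ Ω V h I T) →
      ∃! χ : ℝ, EinsteinScalar.IsFamilyMember n ε κ Λ I T χ) := by
  have hn3 : 3 ≤ n := by omega
  have hn' : (3 : ℝ) ≤ n := by exact_mod_cast hn3
  have hε1 : ε * ε = 1 := by rcases hε with rfl | rfl <;> norm_num
  refine ⟨fun χ hχ => ⟨?_, ?_⟩, ?_, ?_⟩
  · obtain ⟨Ω, V, h, hs, -⟩ := exists_isSeed hn3 hε (familyCosm (n + 1) ε χ) one_pos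
    exact ⟨Ω, V, h, hs⟩
  · intro Ω V h I e hs hI hc he
    have hr : 0 < √(-χ) := Real.sqrt_pos.2 (by linarith)
    set T : Template := ⟨1 / ((n : ℝ) - 1), ((n : ℝ) - 3) / (n - 2) * (1 - 1 / ((n : ℝ) - 1)),
      e * √(n / (κ * (n - 1))), e * √((n - 1) / (κ * n)), fun y => √(-χ) * y⟩ with hTdef
    have hT : IsFamilyTemplate n κ e T := ⟨rfl, rfl, rfl, rfl⟩
    have hmet : T.metric ε V h = familyMetric ε χ V h := by
      funext p
      rw [hT.metric_eq (Y := p 0) χ rfl, Fin.cons_self_tail]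
    have hfld : T.field V = familyField κ e χ V := by
      funext p
      rw [hT.field_eq (Y := p 0) hn3 hκ χ rfl, Fin.cons_self_tail]
    have hsol := hT.solution hn3 hκ he hε1 hχ hs hI rfl
    refine ⟨by rwa [← hmet, ← hfld], T, _, hT.hasFamilyParameters hn3 hκ he,
      ⟨hs, ?_, hI, hc, (contDiff_const.mul contDiff_id).contDiffOn, ?_, hsol⟩, hmet, hfld⟩
    -- The map from χ to Λ is injective and sends 0 to 0, so χ < 0 gives Λ ≠ 0.
    · intro h0
      have hz : familyCosm (n + 1) ε χ = familyCosm (n + 1) ε 0 := by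
        rw [h0, familyCosm, mul_zero]
      exact hχ.ne (familyCosm_injective hn3 hε1 hz)
    · obtain ⟨y, hy⟩ := hc.nonempty
      obtain ⟨r, hr0, hb⟩ := Metric.isOpen_iff.1 hI y hy
      refine ⟨y, hy, y + r / 2, hb ?_, ?_⟩
      · rw [Metric.mem_ball, Real.dist_eq, add_sub_cancel_left, abs_of_pos (by linarith)]
        linarith
      · intro h'
        have := mul_left_cancel₀ hr.ne' h'
        linarith
  · intro Λ Ω V h I T hT H
    exact H.existsUnique_familyMember hn3 hκ hε1 ((Template.isTransformation_iff hn3).1 hT)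
  · intro Λ I T hΛ H
    -- Existence of a seed keeps the hypothesis from being vacuous; once β = 0, any single seed
    -- reduces the claim to part (2).
    obtain ⟨Ω, V, h, hs, -⟩ := exists_isSeed hn3 hε Λ one_pos
    exact (H Ω V h hs).existsUnique_familyMember hn3 hκ hε1
      (Template.β_eq_zero_of_forall_seed hn3 hε hΛ H)
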